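/- Let $\mathcal F$ be a signature (function symbols with fixed arities) and $\mathcal V$ a countably infinite set of variables. Let $\mathcal T(\mathcal F,\mathcal V)$ be the set of terms, and let $\mathcal C(\mathcal F,\mathcal V)=\mathcal T(\mathcal F\cup\{\square\},\mathcal V)$ be the set of contexts, where the hole $\square$ is a fresh constant; contexts may contain any number of holes, and terms are the contexts without holes. Let $\sqsubseteq$ be the smallest reflexive and transitive relation on contexts that is monotone (closed under function symbols) and satisfies $\square\sqsubseteq C$ for all $C$, and let $C\sqcup D$ be the supremum of $C$ and $D$ with respect to $\sqsubseteq$, if it exists. $C|_p$ is the subterm of $C$ at the position $p$, $C[D]_p$ is the result of replacing it by $D$, and $\mathcal{P}\mathrm{os}_{\mathcal F}(C)$ is the set of positions of $C$ at which the subterm is rooted by a symbol of $\mathcal F$. A TRS $\mathcal R$ over $\mathcal F$ is a set of rules $\ell\to r$ with $\ell,r\in\mathcal T(\mathcal F,\mathcal V)$, $\ell\notin\mathcal V$ and $\mathrm{Var}(r)\subseteq\mathrm{Var}(\ell)$; it is left-linear if in every left-hand side $\ell$ each variable occurs at most once. We write $s\to_{p,\ell\to r}t$ for a step with the rule $\ell\to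 r$ at the position $p$ (also on contexts), and $\to_{\mathcal R}$ for the rewrite relation on terms. A relation $\to$ is confluent if any $b,c$ with $a\to^*b$ and $a\to^*c$ for some $a$ have a $d$ with $b\to^*d$ and $c\to^*d$. It is confluent on a set $S$ if $S$ is closed under $\to$ and ${\to}\cap(S\times S)$ is confluent. Let $\mathbb L\subseteq\mathcal C(\mathcal F,\mathcal V)$. A top of a context $C$ is an $L\in\mathbb L$ with $L\sqsubseteq C$; a max-top of $C$ is a top of $C$ that is maximal with respect to $\sqsubseteq$ among the tops of $C$. The set $\mathbb L$ is a layer system if - (L1) each term in $\mathcal T(\mathcal F,\mathcal V)$ has a top different from $\square$; - (L2) for all $x\in\mathcal V$, all contexts $C$ and all positions $p$ of $C$: $C[x]_p\in\mathbb L$ if and only if $C[\square]_p\in\mathbb L$; - (L3) if $L,N\in\mathbb L$, $p\in\mathcal{P}\mathrm{os}_{\mathcal F}(L)$ and $L|_p\sqcup N$ is defined, then $L[L|_p\sqcup N]_p\in\mathbb L$. In a layer system every term $t$ has exactly one max-top $M$, and $M\ne\square$. Write $t=M[t_1,\dots,t_n]$, where the holes of $M$ are filled with $t_1,\dots,t_n$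 from left to right, and define recursively $\mathrm{rank}(t)=1+\max\{\mathrm{rank}(t_i)\mid 1\le i\le n\}$, with $\max\varnothing=0$. A TRS $\mathcal R$ is weakly layered according to $\mathbb L$ if every rule $\ell\to r\in\mathcal R$ satisfies - (W) if $M$ is a max-top of a term $s$, $p\in\mathcal{P}\mathrm{os}_{\mathcal F}(M)$ and $s\to_{p,\ell\to r}t$, then $M\to_{p,\ell\to r}L$ for some $L\in\mathbb L$. **Theorem.** Let $\mathbb L$ be a layer system and let $\mathcal R$ be a TRS that is weakly layered according to $\mathbb L$. If $\mathcal R$ is left-linear and $\to_{\mathcal R}$ is confluent on the set of terms of rank one, then $\to_{\mathcal R}$ is confluent on all terms in $\mathcal T(\mathcal F,\mathcal V)$. -/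

import Mathlib

universe u v w w'

namespace Rewriting

/-! ### Terms, positions, rewriting

A signature is given by the function symbols of a first-order language `F` (a symbol of arity `n` is
an element of `F.Functions n`; relation symbols play no role), and the terms over the signature with
variables in `V` are the elements of `F.Term V`. -/

variable {F : FirstOrder.Language.{u, v}} {V : Type w} {W : Type w'}

/-- The subterm `t|_p` of `t` at the position `p`, and `none` if `p` is not a position of `t`.
A position is the string of argument indices (counted from `0`) that leads from the root down. -/
def subtermAt : F.Term W → List ℕ → Option (F.Term W)
  | t, [] => some t
  | .var _, _ :: _ => none
  | @FirstOrder.Language.Term.func _ _ n _ ts, i :: p => if h : i < n then subtermAt (ts ⟨i, h⟩) p else none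

/-- The term `t[s]_p`: the subterm of `t` at the position `p` is replaced by `s`. -/
def replaceAt : F.Term W → List ℕ → F.Term W → F.Term W
  | _, [], s => s
  | .var x, _ :: _, _ => .var x
  | .func f ts, i :: p, s =>
      .func f (fun j => if (j : ℕ) = i then replaceAt (ts j) p s else ts j)

/-- The set `Pos(t)` of positions of `t`. -/
def positions (t : F.Term W) : Set (List ℕ) := {p | (subtermAt t p).isSome}

/-- The set `Pos_F(t)` of positions of `t` where the subterm is rooted by a function symbol. -/
def funPositions (t : F.Term W) : Set (List ℕ) :=
  {p | ∃ (n : ℕ) (f : F.Functions n) (ts : Fin n → F.Term W), subtermAt t p = some (.func f ts)}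

/-- The set `Var(t)` of variables occurring in `t`. -/
def vars (t : F.Term W) : Set W := {x | ∃ p, subtermAt t p = some (.var x)}

/-- A term is linear if every variable occurs in it at most once. -/
def IsLinear (t : F.Term W) : Prop :=
  ∀ (x : W) (p q : List ℕ),
    subtermAt t p = some (.var x) → subtermAt t q = some (.var x) → p = q

/-- A rewrite rule `lhs → rhs`: the left-hand side is not a variable and contains all variables of
the right-hand side. -/
structure Rule (F : FirstOrder.Language.{u, v}) (V : Type w) where
  lhs : F.Term V
  rhs : F.Term V
  lhs_ne_var : ∀ x : V, lhs ≠ .var x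
  vars_rhs_subset : vars rhs ⊆ vars lhs

/-- A term rewrite system over the signature `F` and the variables `V`. -/
abbrev TRS (F : FirstOrder.Language.{u, v}) (V : Type w) := Set (Rule F V)

/-- All left-hand sides are linear. -/
def LeftLinear (R : TRS F V) : Prop := ∀ ρ ∈ R, IsLinear ρ.lhs

/-- The step `s →_{p,ρ} t`, using the rule `ρ` at the position `p`. The rule has variables in `V`,
the rewritten objects are terms with variables in `W`: for `W = V` these are the terms, and for
`W = Option V` the contexts below. -/
def StepAt (ρ : Rule F V) (p : List ℕ) (s t : F.Term W) : Prop :=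
  ∃ σ : V → F.Term W,
    subtermAt s p = some (ρ.lhs.subst σ) ∧ t = replaceAt s p (ρ.rhs.subst σ)

/-- The rewrite relation of `R` on terms. -/
def Step (R : TRS F V) (s t : F.Term V) : Prop := ∃ ρ ∈ R, ∃ p, StepAt ρ p s t

/-- Confluence of a relation. -/
def Confluent {A : Type*} (r : A → A → Prop) : Prop :=
  ∀ a b c, Relation.ReflTransGen r a b → Relation.ReflTransGen r a c →
    ∃ d, Relation.ReflTransGen r b d ∧ Relation.ReflTransGen r c d

/-- Confluence of a relation on a set: the set is closed under the relation, and the restriction of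
the relation to the set is confluent. -/
def ConfluentOn {A : Type*} (r : A → A → Prop) (S : Set A) : Prop :=
  (∀ a ∈ S, ∀ b, r a b → b ∈ S) ∧ Confluent (fun a b => r a b ∧ a ∈ S ∧ b ∈ S)

/-! ### Contexts -/

/-- Contexts with an arbitrary number of holes: terms over the variables and one further symbol
`none`, the hole. The hole is not a variable: substitutions of rewrite steps act on `V` only. -/
abbrev Ctx (F : FirstOrder.Language.{u, v}) (V : Type w) := F.Term (Option V)

/-- The hole, that is, the empty context. -/
def hole : Ctx F V := .var none

/-- Terms are the contexts without holes. -/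
def toCtx (t : F.Term V) : Ctx F V := t.relabel some

/-- The order `C ⊑ D` on contexts: `D` arises from `C` by replacing holes by contexts. -/
inductive CtxLE : Ctx F V → Ctx F V → Prop
  | hole (C : Ctx F V) : CtxLE hole C
  | var (x : V) : CtxLE (.var (some x)) (.var (some x))
  | func {n : ℕ} (f : F.Functions n) (Cs Ds : Fin n → Ctx F V) (h : ∀ i, CtxLE (Cs i) (Ds i)) :
      CtxLE (.func f Cs) (.func f Ds)

theorem CtxLE.refl (C : Ctx F V) : CtxLE C C := by
  induction C with
  | var x =>
    cases x with
    | none => exact .hole _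
    | some x => exact .var x
  | func f ts ih => exact .func f ts ts ih

theorem CtxLE.trans {C D E : Ctx F V} (h₁ : CtxLE C D) (h₂ : CtxLE D E) : CtxLE C E := by
  induction h₁ generalizing E with
  | hole C => exact .hole _
  | var x => exact h₂
  | func f Cs Ds _ ih =>
    cases h₂ with
    | func _ _ Es h => exact .func f Cs Es (fun i => ih i (h i))

/-- `E` is the merge `C ⊔ D`, the supremum of `C` and `D` with respect to `⊑`. The merge is defined
if there is such an `E`. -/
def IsMerge (C D E : Ctx F V) : Prop :=
  CtxLE C E ∧ CtxLE D E ∧ ∀ E', CtxLE C E' → CtxLE D E' → CtxLE E E'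

/-! ### Layer systems -/

/-- `M` is a top of `C` according to the set `𝕃` of contexts. -/
def IsTop (𝕃 : Set (Ctx F V)) (M C : Ctx F V) : Prop := M ∈ 𝕃 ∧ CtxLE M C

/-- `M` is a max-top of `C`: it is maximal among the tops of `C`. -/
def IsMaxTop (𝕃 : Set (Ctx F V)) (M C : Ctx F V) : Prop :=
  IsTop 𝕃 M C ∧ ∀ N, IsTop 𝕃 N C → CtxLE M N → M = N

/-- Layer systems: the conditions (L1), (L2) and (L3). -/
structure IsLayerSystem (𝕃 : Set (Ctx F V)) : Prop where
  /-- Each term has a non-empty top. -/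
  L1 : ∀ t : F.Term V, ∃ M, IsTop 𝕃 M (toCtx t) ∧ M ≠ hole
  /-- `C[x]_p ∈ 𝕃` if and only if `C[□]_p ∈ 𝕃`. -/
  L2 : ∀ (x : V) (C : Ctx F V), ∀ p ∈ positions C,
    replaceAt C p (.var (some x)) ∈ 𝕃 ↔ replaceAt C p hole ∈ 𝕃
  /-- If `L, N ∈ 𝕃`, `p ∈ Pos_F(L)`, and `E = L|_p ⊔ N` is defined, then `L[E]_p ∈ 𝕃`. -/
  L3 : ∀ L ∈ 𝕃, ∀ N ∈ 𝕃, ∀ p ∈ funPositions L, ∀ D E : Ctx F V,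
    subtermAt L p = some D → IsMerge D N E → replaceAt L p E ∈ 𝕃

/-- `R` is weakly layered according to `𝕃`: every rule satisfies the condition (W). -/
def WeaklyLayered (R : TRS F V) (𝕃 : Set (Ctx F V)) : Prop :=
  ∀ ρ ∈ R, ∀ (s t : F.Term V) (M : Ctx F V) (p : List ℕ),
    IsMaxTop 𝕃 M (toCtx s) → p ∈ funPositions M → StepAt ρ p s t →
      ∃ L ∈ 𝕃, StepAt ρ p M L

/-- The terms `t₁, …, tₙ` with `t = M[t₁, …, tₙ]`, from left to right, for a context `M ⊑ t`. -/
def aliens : Ctx F V → F.Term V → List (F.Term V)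
  | .var none, t => [t]
  | .var (some _), _ => []
  | .func _ _, .var _ => []
  | @FirstOrder.Language.Term.func _ _ n _ Cs, @FirstOrder.Language.Term.func _ _ m _ ts =>
      (List.ofFn fun i : Fin n =>
        if h : (i : ℕ) < m then aliens (Cs i) (ts ⟨i, h⟩) else []).flatten

/-- The size of a term. -/
def size : F.Term V → ℕ
  | .var _ => 1
  | .func _ ts => 1 + ∑ i, size (ts i)

theorem size_le_of_mem_aliens (M : Ctx F V) (t a : F.Term V) (h : a ∈ aliens M t) :
    size a ≤ size t ∧ (M ≠ hole → size a < size t) := by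
  induction M generalizing t with
  | var x =>
    cases x with
    | none =>
      simp only [aliens, List.mem_singleton] at h
      exact ⟨by rw [h], fun h' => absurd rfl h'⟩
    | some x => simp [aliens] at h
  | func f Cs ih =>
    cases t with
    | var y => simp [aliens] at h
    | func g ts =>
      simp only [aliens, List.mem_flatten, List.mem_ofFn] at h
      obtain ⟨_, ⟨i, rfl⟩, h⟩ := h
      split_ifs at h with hi
      · have h₁ := (ih i _ h).1
        have h₂ : size (ts ⟨i, hi⟩) ≤ ∑ j, size (ts j) :=
          Finset.single_le_sum (f := fun j => size (ts j)) (fun _ _ => Nat.zero_le _)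
            (Finset.mem_univ _)
        simp only [size]
        exact ⟨by omega, fun _ => by omega⟩
      · simp at h

open Classical in
/-- The rank of a term: `rank t = 1 + max {rank t₁, …, rank tₙ}` (with `max ∅ = 0`), where
`t = M[t₁, …, tₙ]` for the max-top `M` of `t`. In a layer system every term has exactly one max-top,
which is not the hole; the value `0` is a default for other sets of contexts. -/
noncomputable def rank (𝕃 : Set (Ctx F V)) (t : F.Term V) : ℕ :=
  if h : ∃ M, IsMaxTop 𝕃 M (toCtx t) ∧ M ≠ hole then
    1 + ((aliens h.choose t).attach.map fun a => rank 𝕃 a.1).foldr max 0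
  else 0
termination_by size t
decreasing_by exact (size_le_of_mem_aliens _ _ _ a.2).2 h.choose_spec.2

end Rewriting

namespace Rewriting

open FirstOrder.Language Relation

variable {F : FirstOrder.Language.{u, v}} {V : Type w} {A B C D W : Type*}

/-! ### Substitution -/

/-! By (L2), exchanging holes and variables does not lead out of `𝕃`, so only the shape of a layer
matters, and `shapes 𝕃` forgets the difference. By (L3), two tops of a term can be merged, so there
is a greatest one; it also absorbs every top of a subterm at one of its function positions
(`IsShapeSystem.saturated`). By (W), a step either stays inside the greatest top and leads to a
layer, or takes place in an alien (`IsShapeSystem.step_cases`). Hence rewriting never increases the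
rank (`RankLE.rew`).

Confluence follows by induction on the rank (`ConfluentUpTo.succ`). In a term of rank at most `m +
2`, replace the aliens of rank larger than `m` by markers, which are just additional variables. The
resulting base has rank at most `m + 1`, so rewriting of bases (short steps) is confluent by
induction. The marked aliens have rank at most `m + 1` as well, so parallel rewriting of them (tall
steps) can be joined by induction. Every rewrite step is short or tall.

Left-linearity makes a rewrite sequence of a base independent of the contents of its markers
(`Lift.rews`). The difficulty is that after a tall step an alien may lose rank or fuse with the
layer above it, so that the new base differs from the old one. By `IsBase.lift_mark` it can only be
a refinement: an alien of rank at most `m + 1` either is still a marker or has become free of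
markers, and then rewriting it is a short step. So the local diagrams close up to a short step after
each tall step, which suffices by `confluent_of_diagrams`. -/

theorem subst_subst (t : F.Term A) (σ : A → F.Term B) (τ : B → F.Term C) :
    (t.subst σ).subst τ = t.subst fun a => (σ a).subst τ := by
  induction t with
  | var a => rfl
  | func f ts ih => simp only [Term.subst, ih]

theorem relabel_eq_subst (t : F.Term A) (g : A → B) :
    t.relabel g = t.subst fun a => Term.var (g a) := by
  induction t with
  | var a => rfl
  | func f ts ih => simp only [Term.subst, Term.relabel, ih]

theorem subst_var (t : F.Term A) : t.subst Term.var = t := by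
  induction t with
  | var a => rfl
  | func f ts ih => simp only [Term.subst, ih]

theorem relabel_subst (t : F.Term A) (g : A → B) (τ : B → F.Term C) :
    (t.relabel g).subst τ = t.subst fun a => τ (g a) := by
  rw [relabel_eq_subst, subst_subst]; rfl

theorem subst_relabel (t : F.Term A) (σ : A → F.Term B) (g : B → C) :
    (t.subst σ).relabel g = t.subst fun a => (σ a).relabel g := by
  simp only [relabel_eq_subst, subst_subst]

theorem relabel_comp (t : F.Term A) (g : A → B) (h : B → C) :
    (t.relabel g).relabel h = t.relabel fun a => h (g a) := by
  rw [relabel_eq_subst _ h, relabel_subst, ← relabel_eq_subst]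

theorem subtermAt_func {n : ℕ} (f : F.Functions n) (ts : Fin n → F.Term A) (i : Fin n)
    (p : List ℕ) : subtermAt (Term.func f ts) (i :: p) = subtermAt (ts i) p := by
  simp [subtermAt]

theorem subtermAt_func_eq_some {n : ℕ} {f : F.Functions n} {ts : Fin n → F.Term A} {i : ℕ}
    {p : List ℕ} {s : F.Term A} (h : subtermAt (Term.func f ts) (i :: p) = some s) :
    ∃ j : Fin n, (j : ℕ) = i ∧ subtermAt (ts j) p = some s := by
  simp only [subtermAt] at h
  split_ifs at h with hi
  exact ⟨⟨i, hi⟩, rfl, h⟩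

theorem subtermAt_relabel (t : F.Term A) (p : List ℕ) (g : A → B) :
    subtermAt (t.relabel g) p = (subtermAt t p).map (Term.relabel g) := by
  induction t generalizing p with
  | var a => cases p <;> simp [subtermAt]
  | func f ts ih =>
    cases p with
    | nil => simp [subtermAt]
    | cons i p =>
      simp only [Term.relabel, subtermAt]
      split_ifs
      · exact ih _ p
      · rfl

theorem replaceAt_relabel (t : F.Term A) (p : List ℕ) (s : F.Term A) (g : A → B) :
    (replaceAt t p s).relabel g = replaceAt (t.relabel g) p (s.relabel g) := by
  induction t generalizing p with
  | var a => cases p <;> simp [replaceAt]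
  | func f ts ih =>
    cases p with
    | nil => simp [replaceAt]
    | cons i p =>
      simp only [Term.relabel, replaceAt]
      congr 1
      funext j
      split_ifs
      · exact ih j p
      · rfl

theorem mem_funPositions_relabel {t : F.Term A} {p : List ℕ} (g : A → B) :
    p ∈ funPositions (t.relabel g) ↔ p ∈ funPositions t := by
  simp only [funPositions, Set.mem_ofPred_eq, subtermAt_relabel, Option.map_eq_some_iff]
  constructor
  · rintro ⟨n, f, ts, u, hu, h⟩
    cases u with
    | var a => simp at h
    | func f ts => exact ⟨_, f, ts, hu⟩
  · rintro ⟨n, f, ts, h⟩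
    exact ⟨n, f, _, _, h, rfl⟩

theorem replaceAt_func {n : ℕ} (f : F.Functions n) (ts : Fin n → F.Term A) (i : Fin n)
    (p : List ℕ) (s : F.Term A) : replaceAt (Term.func f ts) (i :: p) s =
      Term.func f (Function.update ts i (replaceAt (ts i) p s)) := by
  simp only [replaceAt]
  congr 1
  funext j
  by_cases h : j = i
  · subst h; simp
  · have : (j : ℕ) ≠ i := fun h' => h (Fin.ext h')
    simp [this, h]

theorem vars_var (a : A) : vars (Term.var a : F.Term A) = {a} := by
  ext x
  constructor
  · rintro ⟨p, hp⟩
    cases p with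
    | nil => simpa [subtermAt, eq_comm] using hp
    | cons i p => simp [subtermAt] at hp
  · rintro rfl
    exact ⟨[], rfl⟩

theorem mem_vars_func {n : ℕ} {f : F.Functions n} {ts : Fin n → F.Term A} {x : A} :
    x ∈ vars (Term.func f ts) ↔ ∃ i, x ∈ vars (ts i) := by
  constructor
  · rintro ⟨p, hp⟩
    cases p with
    | nil => simp [subtermAt] at hp
    | cons i p =>
      obtain ⟨j, -, hj⟩ := subtermAt_func_eq_some hp
      exact ⟨j, p, hj⟩
  · rintro ⟨i, p, hp⟩
    exact ⟨i :: p, by rw [subtermAt_func, hp]⟩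

theorem vars_finite (t : F.Term A) : (vars t).Finite := by
  induction t with
  | var a => rw [vars_var]; exact Set.finite_singleton a
  | func f ts ih =>
    have : vars (Term.func f ts) = ⋃ i, vars (ts i) := by
      ext x; simp [mem_vars_func]
    rw [this]
    exact Set.finite_iUnion ih

theorem subst_congr {t : F.Term A} {σ τ : A → F.Term B} (h : ∀ x ∈ vars t, σ x = τ x) :
    t.subst σ = t.subst τ := by
  induction t with
  | var a => exact h a (by rw [vars_var]; rfl)
  | func f ts ih =>
    simp only [Term.subst]
    congr 1
    funext i
    exact ih i fun x hx => h x (mem_vars_func.2 ⟨i, hx⟩)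

theorem mem_vars_subst {t : F.Term A} {σ : A → F.Term B} {y : B} :
    y ∈ vars (t.subst σ) ↔ ∃ x ∈ vars t, y ∈ vars (σ x) := by
  induction t with
  | var a => simp [Term.subst, vars_var]
  | func f ts ih =>
    simp only [Term.subst, mem_vars_func, ih]
    constructor
    · rintro ⟨i, x, hx, hy⟩; exact ⟨x, ⟨i, hx⟩, hy⟩
    · rintro ⟨x, ⟨i, hx⟩, hy⟩; exact ⟨i, x, hx, hy⟩

theorem IsLinear.arg {n : ℕ} {f : F.Functions n} {ts : Fin n → F.Term A}
    (h : IsLinear (Term.func f ts)) (i : Fin n) : IsLinear (ts i) := by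
  intro x p q hp hq
  have := h x (i :: p) (i :: q) (by rw [subtermAt_func, hp]) (by rw [subtermAt_func, hq])
  simpa using this

theorem IsLinear.eq_of_mem_vars {n : ℕ} {f : F.Functions n} {ts : Fin n → F.Term A}
    (h : IsLinear (Term.func f ts)) {i j : Fin n} {x : A} (hi : x ∈ vars (ts i))
    (hj : x ∈ vars (ts j)) : i = j := by
  obtain ⟨p, hp⟩ := hi
  obtain ⟨q, hq⟩ := hj
  have := h x (i :: p) (j :: q) (by rw [subtermAt_func, hp]) (by rw [subtermAt_func, hq])
  simp only [List.cons.injEq] at this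
  exact Fin.ext this.1

/-! ### Replacing the occurrences of variables independently of each other -/

/-- `Lift k s t`: the term `t` arises from `s` by replacing every occurrence of a variable `a`,
independently of the other occurrences, by some term related to `a` by `k`. -/
inductive Lift (k : A → F.Term B → Prop) : F.Term A → F.Term B → Prop
  | var {a : A} {t : F.Term B} (h : k a t) : Lift k (.var a) t
  | func {n : ℕ} (f : F.Functions n) {ss : Fin n → F.Term A} {ts : Fin n → F.Term B}
      (h : ∀ i, Lift k (ss i) (ts i)) : Lift k (.func f ss) (.func f ts)

theorem lift_var_iff {k : A → F.Term B → Prop} {a : A} {t : F.Term B} :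
    Lift k (.var a) t ↔ k a t := by
  constructor
  · intro h
    cases h with
    | var h => exact h
  · exact .var

theorem lift_func_iff {k : A → F.Term B → Prop} {n : ℕ} {f : F.Functions n}
    {ss : Fin n → F.Term A} {t : F.Term B} :
    Lift k (.func f ss) t ↔ ∃ ts, t = .func f ts ∧ ∀ i, Lift k (ss i) (ts i) := by
  constructor
  · intro h
    cases h with
    | func _ h => exact ⟨_, rfl, h⟩
  · rintro ⟨ts, rfl, h⟩
    exact .func f h

theorem lift_func_func_iff {k : A → F.Term B → Prop} {n : ℕ} {f : F.Functions n}
    {ss : Fin n → F.Term A} {ts : Fin n → F.Term B} :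
    Lift k (.func f ss) (.func f ts) ↔ ∀ i, Lift k (ss i) (ts i) := by
  constructor
  · intro h
    cases h with
    | func _ h => exact h
  · exact .func f

theorem Lift.mono {k l : A → F.Term B → Prop} {s : F.Term A} {t : F.Term B} (h : Lift k s t)
    (hkl : ∀ a b, k a b → l a b) : Lift l s t := by
  induction h with
  | var h => exact .var (hkl _ _ h)
  | func f _ ih => exact .func f ih

theorem Lift.relabel {k : A → F.Term B → Prop} {l : A → F.Term C → Prop} {s : F.Term A}
    {t : F.Term B} (h : Lift k s t) (g : B → C) (hkl : ∀ a b, k a b → l a (b.relabel g)) :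
    Lift l s (t.relabel g) := by
  induction h with
  | var h => exact .var (hkl _ _ h)
  | func f _ ih => exact .func f ih

theorem Lift.subst {k : A → F.Term B → Prop} {σ : V → F.Term A} {τ : V → F.Term B}
    {t : F.Term V} (h : ∀ x ∈ vars t, Lift k (σ x) (τ x)) : Lift k (t.subst σ) (t.subst τ) := by
  induction t with
  | var x => exact h x (by rw [vars_var]; rfl)
  | func f ts ih => exact .func f fun i => ih i fun x hx => h x (mem_vars_func.2 ⟨i, hx⟩)

theorem lift_of_lift_subst {k : A → F.Term B → Prop} {σ : V → F.Term A} {τ : V → F.Term B}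
    {t : F.Term V} (h : Lift k (t.subst σ) (t.subst τ)) : ∀ x ∈ vars t, Lift k (σ x) (τ x) := by
  induction t with
  | var x =>
    intro y hy
    rw [vars_var] at hy
    rw [hy]
    exact h
  | func f ts ih =>
    intro x hx
    obtain ⟨i, hi⟩ := mem_vars_func.1 hx
    simp only [Term.subst, lift_func_func_iff] at h
    exact ih i (h i) x hi

/-- The occurrences of variables below `l` may be replaced differently, but each variable of a
linear `l` has a single occurrence, so the result still matches `l`. This is how left-linearity
enters the proof. -/
theorem IsLinear.exists_subst_of_lift [Nonempty B] {k : A → F.Term B → Prop} {σ : V → F.Term A}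
    {l : F.Term V} (hl : IsLinear l) {t : F.Term B} (h : Lift k (l.subst σ) t) :
    ∃ τ : V → F.Term B, t = l.subst τ ∧ ∀ x ∈ vars l, Lift k (σ x) (τ x) := by
  classical
  induction l generalizing t with
  | var x =>
    refine ⟨fun _ => t, rfl, fun y hy => ?_⟩
    rw [vars_var] at hy
    rw [hy]
    exact h
  | func f ls ih =>
    simp only [Term.subst, lift_func_iff] at h
    obtain ⟨ts, rfl, h⟩ := h
    choose τ hτ hk using fun i => ih i (hl.arg i) (h i)
    -- The substitutions of the arguments are glued together: by linearity at most one argument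
    -- contains `x`. Variables outside of `l` get an arbitrary value.
    have key : ∀ i, ∀ x ∈ vars (ls i),
        (if h : ∃ j, x ∈ vars (ls j) then τ h.choose x else .var (Classical.arbitrary B)) =
          τ i x := by
      intro i x hx
      have h' : ∃ j, x ∈ vars (ls j) := ⟨i, hx⟩
      rw [dif_pos h', hl.eq_of_mem_vars h'.choose_spec hx]
    refine ⟨fun x => if h : ∃ j, x ∈ vars (ls j) then τ h.choose x
      else .var (Classical.arbitrary B), ?_, ?_⟩
    · simp only [Term.subst]
      congr 1
      funext i
      rw [hτ i]
      exact subst_congr fun x hx => (key i x hx).symm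
    · intro x hx
      obtain ⟨i, hi⟩ := mem_vars_func.1 hx
      dsimp only
      rw [key i x hi]
      exact hk i x hi

/-! ### Rewriting without positions -/

/-- The rewrite relation of `R` on terms with variables in any type. -/
inductive Rew (R : TRS F V) : F.Term A → F.Term A → Prop
  | root {ρ : Rule F V} (hρ : ρ ∈ R) (σ : V → F.Term A) : Rew R (ρ.lhs.subst σ) (ρ.rhs.subst σ)
  | arg {n : ℕ} (f : F.Functions n) (ts : Fin n → F.Term A) (i : Fin n) {t : F.Term A}
      (h : Rew R (ts i) t) : Rew R (.func f ts) (.func f (Function.update ts i t))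

theorem rew_iff {R : TRS F V} {s t : F.Term A} :
    Rew R s t ↔ ∃ ρ ∈ R, ∃ p, StepAt ρ p s t := by
  constructor
  · intro h
    induction h with
    | root hρ σ => exact ⟨_, hρ, [], σ, by simp [subtermAt], by simp [replaceAt]⟩
    | arg f ts i _ ih =>
      obtain ⟨ρ, hρ, p, σ, hp, ht⟩ := ih
      exact ⟨ρ, hρ, i :: p, σ, by rw [subtermAt_func, hp], by rw [replaceAt_func, ht]⟩
  · rintro ⟨ρ, hρ, p, σ, hp, rfl⟩
    induction p generalizing s with
    | nil =>
      simp only [subtermAt, Option.some.injEq] at hp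
      rw [hp]
      simpa [replaceAt] using Rew.root hρ σ
    | cons i p ih =>
      cases s with
      | var x => simp [subtermAt] at hp
      | func f ts =>
        obtain ⟨j, rfl, hj⟩ := subtermAt_func_eq_some hp
        rw [replaceAt_func]
        exact .arg f ts j (ih hj)

theorem lhs_eq_func (ρ : Rule F V) : ∃ (n : ℕ) (f : F.Functions n) (ts : Fin n → F.Term V),
    ρ.lhs = .func f ts := by
  rcases h : ρ.lhs with x | ⟨f, ts⟩
  · exact absurd h (ρ.lhs_ne_var x)
  · exact ⟨_, f, ts, rfl⟩

theorem not_rew_var {R : TRS F V} {a : A} {t : F.Term A} : ¬ Rew R (.var a) t := by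
  intro h
  generalize hs : (Term.var a : F.Term A) = s at h
  cases h with
  | root hρ σ =>
    rename_i ρ
    obtain ⟨n, f, ts, h⟩ := lhs_eq_func ρ
    rw [h] at hs
    cases hs
  | arg f ts i h => cases hs

theorem Rew.subst {R : TRS F V} {s t : F.Term A} (h : Rew R s t) (τ : A → F.Term B) :
    Rew R (s.subst τ) (t.subst τ) := by
  induction h with
  | root hρ σ =>
    rw [subst_subst, subst_subst]
    exact .root hρ _
  | arg f ts i _ ih =>
    simp only [Term.subst]
    convert Rew.arg f (fun j => (ts j).subst τ) i ih using 2
    funext j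
    by_cases h : j = i
    · subst h; simp
    · simp [h]

theorem Rew.relabel {R : TRS F V} {s t : F.Term A} (h : Rew R s t) (g : A → B) :
    Rew R (s.relabel g) (t.relabel g) := by
  rw [relabel_eq_subst, relabel_eq_subst]
  exact h.subst _

theorem rews_subst {R : TRS F V} {s t : F.Term A} (h : ReflTransGen (Rew R) s t)
    (τ : A → F.Term B) : ReflTransGen (Rew R) (s.subst τ) (t.subst τ) :=
  h.lift (fun s => s.subst τ) fun _ _ h => h.subst τ

theorem rews_relabel {R : TRS F V} {s t : F.Term A} (h : ReflTransGen (Rew R) s t)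
    (g : A → B) : ReflTransGen (Rew R) (s.relabel g) (t.relabel g) :=
  h.lift (fun s => s.relabel g) fun _ _ h => h.relabel g

theorem rews_arg {R : TRS F V} {n : ℕ} (f : F.Functions n) (ts : Fin n → F.Term A) (i : Fin n)
    {t : F.Term A} (h : ReflTransGen (Rew R) (ts i) t) :
    ReflTransGen (Rew R) (.func f ts) (.func f (Function.update ts i t)) := by
  induction h with
  | refl => rw [Function.update_eq_self]
  | tail _ h ih =>
    refine ih.tail ?_
    rename_i b c _
    have := Rew.arg (R := R) f (Function.update ts i b) i (t := c) (by simpa using h)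
    simpa using this

theorem rews_func {R : TRS F V} {n : ℕ} (f : F.Functions n) {ss ts : Fin n → F.Term A}
    (h : ∀ i, ReflTransGen (Rew R) (ss i) (ts i)) :
    ReflTransGen (Rew R) (.func f ss) (.func f ts) := by
  classical
  -- `I` collects the arguments that have already been rewritten.
  have key : ∀ I : Finset (Fin n),
      ReflTransGen (Rew R) (.func f ss) (.func f fun i => if i ∈ I then ts i else ss i) := by
    intro I
    induction I using Finset.induction_on with
    | empty => simpa using ReflTransGen.refl
    | insert i I hi ih =>
      refine ih.trans ?_
      have := rews_arg (R := R) f (fun j => if j ∈ I then ts j else ss j) i (t := ts i)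
        (by simpa [hi] using h i)
      convert this using 2
      funext j
      by_cases hj : j = i
      · subst hj; simp
      · simp [hj]
  simpa using key Finset.univ

theorem rews_subst_of_forall {R : TRS F V} (t : F.Term A) {σ τ : A → F.Term B}
    (h : ∀ a, ReflTransGen (Rew R) (σ a) (τ a)) :
    ReflTransGen (Rew R) (t.subst σ) (t.subst τ) := by
  induction t with
  | var a => exact h a
  | func f ts ih => exact rews_func f ih

theorem Rew.vars_subset {R : TRS F V} {s t : F.Term A} (h : Rew R s t) : vars t ⊆ vars s := by
  induction h with
  | root hρ σ =>
    rename_i ρ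
    intro y hy
    obtain ⟨x, hx, hy⟩ := mem_vars_subst.1 hy
    exact mem_vars_subst.2 ⟨x, ρ.vars_rhs_subset hx, hy⟩
  | arg f ts i _ ih =>
    intro y hy
    obtain ⟨j, hj⟩ := mem_vars_func.1 hy
    by_cases h : j = i
    · subst h
      exact mem_vars_func.2 ⟨j, ih (by simpa using hj)⟩
    · exact mem_vars_func.2 ⟨j, by simpa [h] using hj⟩

theorem rews_vars_subset {R : TRS F V} {s t : F.Term A} (h : ReflTransGen (Rew R) s t) :
    vars t ⊆ vars s := by
  induction h with
  | refl => exact subset_rfl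
  | tail _ h ih => exact h.vars_subset.trans ih

/-- Steps with left-linear rules commute with the independent replacement of variables. -/
theorem Lift.rew [Nonempty B] {R : TRS F V} (hR : LeftLinear R) {k : A → F.Term B → Prop}
    {s t : F.Term A} {s' : F.Term B} (h : Lift k s s') (hst : Rew R s t) :
    ∃ t', Rew R s' t' ∧ Lift k t t' := by
  induction hst generalizing s' with
  | root hρ σ =>
    rename_i ρ
    obtain ⟨τ, rfl, hτ⟩ := (hR ρ hρ).exists_subst_of_lift h
    exact ⟨_, .root hρ τ, Lift.subst fun x hx => hτ x (ρ.vars_rhs_subset hx)⟩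
  | arg f ts i _ ih =>
    obtain ⟨ss, rfl, hss⟩ := lift_func_iff.1 h
    obtain ⟨t', ht, hk⟩ := ih (hss i)
    refine ⟨_, .arg f ss i ht, .func f fun j => ?_⟩
    by_cases hj : j = i
    · subst hj; simpa using hk
    · simpa [hj] using hss j

theorem Lift.rews [Nonempty B] {R : TRS F V} (hR : LeftLinear R) {k : A → F.Term B → Prop}
    {s t : F.Term A} {s' : F.Term B} (h : Lift k s s') (hst : ReflTransGen (Rew R) s t) :
    ∃ t', ReflTransGen (Rew R) s' t' ∧ Lift k t t' := by
  induction hst with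
  | refl => exact ⟨s', .refl, h⟩
  | tail _ h ih =>
    obtain ⟨t', ht, hk⟩ := ih
    obtain ⟨u, hu, hk⟩ := hk.rew hR h
    exact ⟨u, ht.tail hu, hk⟩

/-! ### Shapes and tops -/

/-- Shapes: contexts where variables and holes are not told apart. -/
abbrev Shape (F : FirstOrder.Language.{u, v}) := F.Term Unit

/-- The term `t` arises from the shape `D` by replacing the holes by terms. -/
def Below (D : Shape F) (t : F.Term A) : Prop := Lift (fun _ _ => True) D t

theorem below_var (t : F.Term A) : Below (.var () : Shape F) t := .var trivial

theorem below_func_iff {n : ℕ} {f : F.Functions n} {Ds : Fin n → Shape F} {t : F.Term A} :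
    Below (.func f Ds) t ↔ ∃ ts, t = .func f ts ∧ ∀ i, Below (Ds i) (ts i) := lift_func_iff

theorem below_func_func_iff {n : ℕ} {f : F.Functions n} {Ds : Fin n → Shape F}
    {ts : Fin n → F.Term A} : Below (.func f Ds) (.func f ts) ↔ ∀ i, Below (Ds i) (ts i) :=
  lift_func_func_iff

theorem below_of_lift {k : Unit → F.Term A → Prop} {D : Shape F} {t : F.Term A}
    (h : Lift k D t) : Below D t := h.mono fun _ _ _ => trivial

theorem Below.refl (D : Shape F) : Below D D := by
  induction D with
  | var a => exact below_var _
  | func f Ds ih => exact .func f ih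

theorem below_relabel_iff {D : Shape F} {t : F.Term A} {g : A → B} :
    Below D (t.relabel g) ↔ Below D t := by
  constructor
  · intro h
    induction D generalizing t with
    | var a => exact .var trivial
    | func f Ds ih =>
      obtain ⟨ts, ht, h⟩ := below_func_iff.1 h
      cases t with
      | var a => simp at ht
      | func f' ts' =>
        simp only [Term.relabel, Term.func.injEq] at ht
        obtain ⟨rfl, hf, ht⟩ := ht
        obtain rfl := eq_of_heq hf
        obtain rfl := eq_of_heq ht
        exact .func _ fun i => ih i (h i)
  · intro h
    exact Lift.relabel h g fun _ _ _ => trivial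

theorem below_antisymm {D E : Shape F} (h : Below D E) (hE : Below E D) : D = E := by
  induction D generalizing E with
  | var a =>
    cases E with
    | var b => rfl
    | func f Es => obtain ⟨ts, ht, -⟩ := below_func_iff.1 hE; cases ht
  | func f Ds ih =>
    obtain ⟨Es, rfl, hEs⟩ := below_func_iff.1 h
    rw [below_func_func_iff] at hE
    congr 1
    funext i
    exact ih i (hEs i) (hE i)

/-- `M` is the greatest among the tops of `t` that belong to `𝕊`. -/
def IsGreatestTop (𝕊 : Set (Shape F)) (M : Shape F) (t : F.Term A) : Prop :=
  M ∈ 𝕊 ∧ Below M t ∧ ∀ N ∈ 𝕊, Below N t → Below N M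

theorem isGreatestTop_relabel_iff {𝕊 : Set (Shape F)} {M : Shape F} {t : F.Term A} {g : A → B} :
    IsGreatestTop 𝕊 M (t.relabel g) ↔ IsGreatestTop 𝕊 M t := by
  simp only [IsGreatestTop, below_relabel_iff]

/-- At every function position of `M`, the corresponding part of `M` is above all tops of the
corresponding subterm of `t`. -/
inductive Saturated (𝕊 : Set (Shape F)) : Shape F → F.Term A → Prop
  | var (t : F.Term A) : Saturated 𝕊 (.var ()) t
  | func {n : ℕ} (f : F.Functions n) {Ms : Fin n → Shape F} {ts : Fin n → F.Term A}
      (hmax : ∀ N ∈ 𝕊, Below N (.func f ts) → Below N (.func f Ms))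
      (h : ∀ i, Saturated 𝕊 (Ms i) (ts i)) : Saturated 𝕊 (.func f Ms) (.func f ts)

theorem Saturated.exists_of_func {𝕊 : Set (Shape F)} {n : ℕ} {f : F.Functions n}
    {Ms : Fin n → Shape F} {t : F.Term A} (h : Saturated 𝕊 (.func f Ms) t) :
    ∃ ts, t = .func f ts ∧ (∀ N ∈ 𝕊, Below N t → Below N (.func f Ms)) ∧
      ∀ i, Saturated 𝕊 (Ms i) (ts i) := by
  cases h with
  | func _ hmax h => exact ⟨_, rfl, hmax, h⟩

theorem Saturated.of_relabel {𝕊 : Set (Shape F)} {M : Shape F} {t : F.Term A} {g : A → B}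
    (h : Saturated 𝕊 M (t.relabel g)) : Saturated 𝕊 M t := by
  induction M generalizing t with
  | var a => exact .var _
  | func f Ms ih =>
    cases t with
    | var a => obtain ⟨ts, ht, -⟩ := h.exists_of_func; simp at ht
    | func f' ts' =>
      obtain ⟨ts, ht, hmax, h⟩ := h.exists_of_func
      simp only [Term.relabel, Term.func.injEq] at ht
      obtain ⟨rfl, hf, ht⟩ := ht
      obtain rfl := eq_of_heq hf
      obtain rfl := eq_of_heq ht
      exact .func f' (fun N hN h' => hmax N hN (below_relabel_iff.2 h')) fun i => ih i (h i)

/-- Merging two shapes below a common term. -/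
theorem exists_sup {D E : Shape F} {t : F.Term A} (hD : Below D t) (hE : Below E t) :
    ∃ S : Shape F, Below S t ∧ Below D S ∧ Below E S ∧
      ∀ s : F.Term B, Below D s → Below E s → Below S s := by
  induction t generalizing D E with
  | var a =>
    have : ∀ {D : Shape F}, Below D (.var a : F.Term A) → D = .var () := by
      intro D hD
      cases D with
      | var b => rfl
      | func f Ds => obtain ⟨ts, ht, -⟩ := below_func_iff.1 hD; cases ht
    rw [this hD, this hE]
    exact ⟨.var (), below_var _, below_var _, below_var _, fun _ _ _ => below_var _⟩
  | func f ts ih =>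
    cases D with
    | var a => exact ⟨E, hE, below_var _, .refl E, fun _ _ h => h⟩
    | func g Ds =>
      cases E with
      | var a => exact ⟨_, hD, .refl _, below_var _, fun _ h _ => h⟩
      | func g' Es =>
        obtain ⟨_, h, hD⟩ := below_func_iff.1 hD
        simp only [Term.func.injEq] at h
        obtain ⟨rfl, hf, h⟩ := h
        obtain rfl := eq_of_heq hf
        obtain rfl := eq_of_heq h
        obtain ⟨_, h, hE⟩ := below_func_iff.1 hE
        simp only [Term.func.injEq] at h
        obtain ⟨rfl, hf, h⟩ := h
        obtain rfl := eq_of_heq hf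
        obtain rfl := eq_of_heq h
        choose S h₁ h₂ h₃ h₄ using fun i => ih i (hD i) (hE i)
        refine ⟨.func f S, .func f h₁, .func f h₂, .func f h₃, fun s hs ht => ?_⟩
        obtain ⟨ss, rfl, hss⟩ := below_func_iff.1 hs
        rw [below_func_func_iff] at ht
        exact .func f fun i => h₄ i (ss i) (hss i) (ht i)

/-! ### Steps inside a top and inside an alien -/

/-- The step `s → t` takes place in the part `M` of `s`, where it leads to `N`. -/
inductive TopStep (R : TRS F V) : Shape F → Shape F → F.Term A → F.Term A → Prop
  | root {ρ : Rule F V} (hρ : ρ ∈ R) (σ : V → Shape F) (τ : V → F.Term A) :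
      TopStep R (ρ.lhs.subst σ) (ρ.rhs.subst σ) (ρ.lhs.subst τ) (ρ.rhs.subst τ)
  | arg {n : ℕ} (f : F.Functions n) (Ms : Fin n → Shape F) (ts : Fin n → F.Term A) (i : Fin n)
      {N : Shape F} {t : F.Term A} (h : TopStep R (Ms i) N (ts i) t) :
      TopStep R (.func f Ms) (.func f (Function.update Ms i N)) (.func f ts)
        (.func f (Function.update ts i t))

/-- The step `s → t` takes place below a hole of `M`. -/
inductive AlienStep (R : TRS F V) : Shape F → F.Term A → F.Term A → Prop
  | var {s t : F.Term A} (h : Rew R s t) : AlienStep R (.var ()) s t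
  | arg {n : ℕ} (f : F.Functions n) (Ms : Fin n → Shape F) (ts : Fin n → F.Term A) (i : Fin n)
      {t : F.Term A} (h : AlienStep R (Ms i) (ts i) t) :
      AlienStep R (.func f Ms) (.func f ts) (.func f (Function.update ts i t))

theorem TopStep.lift {R : TRS F V} {M N : Shape F} {s t : F.Term A} (h : TopStep R M N s t)
    {k : Unit → F.Term A → Prop} (hk : Lift k M s) : Lift k N t := by
  induction h with
  | root hρ σ τ =>
    rename_i ρ
    exact Lift.subst fun x hx => lift_of_lift_subst hk x (ρ.vars_rhs_subset hx)
  | arg f Ms ts i _ ih =>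
    rw [lift_func_func_iff] at hk
    refine .func f fun j => ?_
    by_cases hj : j = i
    · subst hj; simpa using ih (hk j)
    · simpa [hj] using hk j

theorem AlienStep.lift {R : TRS F V} {M : Shape F} {s t : F.Term A} (h : AlienStep R M s t)
    {P : F.Term A → Prop} (hP : ∀ a b, P a → Rew R a b → P b) (hk : Lift (fun _ => P) M s) :
    Lift (fun _ => P) M t := by
  induction h with
  | var h => exact .var (hP _ _ (lift_var_iff.1 hk) h)
  | arg f Ms ts i _ ih =>
    rw [lift_func_func_iff] at hk
    refine .func f fun j => ?_
    by_cases hj : j = i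
    · subst hj; simpa using ih (hk j)
    · simpa [hj] using hk j

theorem topStep_replaceAt {R : TRS F V} {ρ : Rule F V} (hρ : ρ ∈ R) {M : Shape F} {s : F.Term A}
    {p : List ℕ} {σ : V → Shape F} {τ : V → F.Term A} (hM : Below M s)
    (hMp : subtermAt M p = some (ρ.lhs.subst σ)) (hsp : subtermAt s p = some (ρ.lhs.subst τ)) :
    TopStep R M (replaceAt M p (ρ.rhs.subst σ)) s (replaceAt s p (ρ.rhs.subst τ)) := by
  induction p generalizing M s with
  | nil =>
    simp only [subtermAt, Option.some.injEq] at hMp hsp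
    rw [hMp, hsp]
    simpa [replaceAt] using TopStep.root hρ σ τ
  | cons i p ih =>
    cases M with
    | var a => simp [subtermAt] at hMp
    | func f Ms =>
      obtain ⟨ts, rfl, h⟩ := below_func_iff.1 hM
      obtain ⟨j, rfl, hj⟩ := subtermAt_func_eq_some hMp
      rw [subtermAt_func] at hsp
      rw [replaceAt_func, replaceAt_func]
      exact .arg f Ms ts j (ih (h j) hj hsp)

theorem alienStep_of_notMem {R : TRS F V} {ρ : Rule F V} (hρ : ρ ∈ R) {M : Shape F}
    {s t : F.Term A} {p : List ℕ} (hM : Below M s) (hst : StepAt ρ p s t)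
    (hp : p ∉ funPositions M) : AlienStep R M s t := by
  induction p generalizing M s t with
  | nil =>
    cases M with
    | var a => exact .var (rew_iff.2 ⟨ρ, hρ, _, hst⟩)
    | func f Ms => exact absurd ⟨_, f, Ms, by simp [subtermAt]⟩ hp
  | cons i p ih =>
    cases M with
    | var a => exact .var (rew_iff.2 ⟨ρ, hρ, _, hst⟩)
    | func f Ms =>
      obtain ⟨ts, rfl, h⟩ := below_func_iff.1 hM
      obtain ⟨σ, hs, rfl⟩ := hst
      obtain ⟨j, rfl, hj⟩ := subtermAt_func_eq_some hs
      rw [replaceAt_func]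
      refine .arg f Ms ts j (ih (h j) ⟨σ, hj, rfl⟩ ?_)
      rintro ⟨n, g, us, hg⟩
      exact hp ⟨n, g, us, by rw [subtermAt_func, hg]⟩

/-! ### Layer systems of shapes -/

/-- A layer system `𝕊` of shapes such that `R` is weakly layered according to `𝕊`. -/
structure IsShapeSystem (R : TRS F V) (𝕊 : Set (Shape F)) : Prop where
  var_mem : .var () ∈ 𝕊
  exists_top : ∀ {n : ℕ} (f : F.Functions n) (ts : Fin n → Shape F),
    ∃ Ds, .func f Ds ∈ 𝕊 ∧ ∀ i, Below (Ds i) (ts i)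
  merge : ∀ L ∈ 𝕊, ∀ N ∈ 𝕊, ∀ p ∈ funPositions L, ∀ D E : Shape F, subtermAt L p = some D →
    Below D E → Below N E → (∀ C : Ctx F V, Below D C → Below N C → Below E C) →
    replaceAt L p E ∈ 𝕊
  step : ∀ ρ ∈ R, ∀ (M s : Shape F) (p : List ℕ) (τ : V → Shape F), IsGreatestTop 𝕊 M s →
    p ∈ funPositions M → subtermAt s p = some (ρ.lhs.subst τ) →
    ∃ σ : V → Shape F, subtermAt M p = some (ρ.lhs.subst σ) ∧ replaceAt M p (ρ.rhs.subst σ) ∈ 𝕊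

/-- The number of function symbols of a shape. -/
def funCount : Shape F → ℕ
  | .var _ => 0
  | .func _ ts => 1 + ∑ i, funCount (ts i)

theorem Below.funCount_le {D E : Shape F} (h : Below D E) : funCount D ≤ funCount E := by
  induction h with
  | var h => simp [funCount]
  | func f _ ih =>
    simp only [funCount]
    exact Nat.add_le_add_left (Finset.sum_le_sum fun i _ => ih i) _

theorem Below.eq_of_funCount_le {D E : Shape F} (h : Below D E)
    (h' : funCount E ≤ funCount D) : D = E := by
  induction h with
  | var h =>
    rename_i a t
    cases t with
    | var b => rfl
    | func f ts => simp [funCount] at h'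
  | func f h ih =>
    rename_i n Ds Es
    congr 1
    funext i
    refine ih i ?_
    simp only [funCount] at h'
    by_contra hlt
    have := Finset.sum_lt_sum (s := Finset.univ) (f := fun i => funCount (Ds i))
      (g := fun i => funCount (Es i))
      (fun i _ => Below.funCount_le (h i)) ⟨i, Finset.mem_univ i, not_le.1 hlt⟩
    omega

theorem replaceAt_nil (t s : F.Term A) : replaceAt t [] s = s := by
  simp [replaceAt]

theorem replaceAt_below {M E D : Shape F} {t u : F.Term A} {p : List ℕ} (h : Below M t)
    (ht : subtermAt t p = some u) (hM : subtermAt M p = some D) (hE : Below E u)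
    (hDE : Below D E) :
    Below (replaceAt M p E) t ∧ Below M (replaceAt M p E) ∧
      subtermAt (replaceAt M p E) p = some E := by
  induction p generalizing M t with
  | nil =>
    simp only [subtermAt, Option.some.injEq] at ht hM
    subst ht hM
    simp only [replaceAt_nil]
    exact ⟨hE, hDE, by simp [subtermAt]⟩
  | cons i p ih =>
    cases M with
    | var a => simp [subtermAt] at hM
    | func f Ms =>
      obtain ⟨ts, rfl, hts⟩ := below_func_iff.1 h
      obtain ⟨j, rfl, hj⟩ := subtermAt_func_eq_some hM
      rw [subtermAt_func] at ht
      obtain ⟨h₁, h₂, h₃⟩ := ih (hts j) ht hj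
      rw [replaceAt_func, below_func_func_iff, below_func_func_iff, subtermAt_func]
      refine ⟨fun l => ?_, fun l => ?_, by simpa using h₃⟩ <;>
      · by_cases hl : l = j
        · subst hl; simpa
        · simpa [hl] using by first | exact hts l | exact .refl _

theorem Saturated.of_positions {𝕊 : Set (Shape F)} {M : Shape F} {t : F.Term A} (h : Below M t)
    (hmax : ∀ p D u, subtermAt M p = some D → p ∈ funPositions M → subtermAt t p = some u →
      ∀ N ∈ 𝕊, Below N u → Below N D) : Saturated 𝕊 M t := by
  induction M generalizing t with
  | var a => exact .var _
  | func f Ms ih =>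
    obtain ⟨ts, rfl, hts⟩ := below_func_iff.1 h
    refine .func f (hmax [] _ _ (by simp [subtermAt]) ⟨_, f, Ms, by simp [subtermAt]⟩
      (by simp [subtermAt])) fun i => ih i (hts i) fun p D u hD hp hu => ?_
    obtain ⟨n, g, us, hg⟩ := hp
    exact hmax (i :: p) D u (by rw [subtermAt_func, hD]) ⟨n, g, us, by rw [subtermAt_func, hg]⟩
      (by rw [subtermAt_func, hu])

/-! ### Greatest tops and the two kinds of steps -/

namespace IsShapeSystem

variable {R : TRS F V} {𝕊 : Set (Shape F)}

/-- A top with the largest number of function symbols is the greatest one: merging it at the root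
with any other top gives a top that cannot have more symbols, hence is equal to it. -/
theorem exists_isGreatestTop (h𝕊 : IsShapeSystem R 𝕊) (t : F.Term A) :
    ∃ M, IsGreatestTop 𝕊 M t := by
  obtain ⟨M, ⟨hM, hMt⟩, hmax⟩ : ∃ M, (M ∈ 𝕊 ∧ Below M t) ∧
      ∀ N, N ∈ 𝕊 ∧ Below N t → funCount N ≤ funCount M := by
    have hb : ∀ N, N ∈ 𝕊 ∧ Below N t → funCount N ≤ funCount (t.relabel fun _ => ()) :=
      fun N hN => Below.funCount_le (below_relabel_iff.2 hN.2)
    have hne : (funCount '' {N | N ∈ 𝕊 ∧ Below N t}).Nonempty :=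
      ⟨_, .var (), ⟨h𝕊.var_mem, below_var _⟩, rfl⟩
    have hbdd : BddAbove (funCount '' {N | N ∈ 𝕊 ∧ Below N t}) := by
      refine ⟨funCount (t.relabel fun _ => ()), ?_⟩
      rintro _ ⟨N, hN, rfl⟩
      exact hb N hN
    obtain ⟨M, hM, hM'⟩ := Nat.sSup_mem hne hbdd
    exact ⟨M, hM, fun N hN => hM' ▸ le_csSup hbdd ⟨N, hN, rfl⟩⟩
  refine ⟨M, hM, hMt, fun N hN hNt => ?_⟩
  cases M with
  | var a =>
    have h0 := hmax N ⟨hN, hNt⟩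
    cases N with
    | var b => exact below_var _
    | func f Ns => simp [funCount] at h0
  | func f Ms =>
    obtain ⟨E, hEt, hME, hNE, hE⟩ := exists_sup (B := Option V) hMt hNt
    have hE𝕊 := h𝕊.merge _ hM N hN [] ⟨_, f, Ms, by simp [subtermAt]⟩ _ E (by simp [subtermAt])
      hME hNE hE
    rw [replaceAt_nil] at hE𝕊
    rw [hME.eq_of_funCount_le (hmax E ⟨hE𝕊, hEt⟩)]
    exact hNE

/-- The greatest top of a term. -/
noncomputable def maxTop (h𝕊 : IsShapeSystem R 𝕊) (t : F.Term A) : Shape F :=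
  (h𝕊.exists_isGreatestTop t).choose

theorem maxTop_spec (h𝕊 : IsShapeSystem R 𝕊) (t : F.Term A) :
    IsGreatestTop 𝕊 (h𝕊.maxTop t) t :=
  (h𝕊.exists_isGreatestTop t).choose_spec

theorem saturated (h𝕊 : IsShapeSystem R 𝕊) {M : Shape F} {t : F.Term A}
    (h : IsGreatestTop 𝕊 M t) : Saturated 𝕊 M t := by
  obtain ⟨hM, hMt, hmax⟩ := h
  refine .of_positions hMt fun p D u hD hp hu N hN hNu => ?_
  have hDu : Below D u := by
    clear hmax hM hp
    induction p generalizing M t with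
    | nil =>
      simp only [subtermAt, Option.some.injEq] at hD hu
      subst hD hu
      exact hMt
    | cons i p ih =>
      cases M with
      | var a => simp [subtermAt] at hD
      | func f Ms =>
        obtain ⟨ts, rfl, h⟩ := below_func_iff.1 hMt
        obtain ⟨j, rfl, hj⟩ := subtermAt_func_eq_some hD
        rw [subtermAt_func] at hu
        exact ih (h j) hj hu
  obtain ⟨E, hEu, hDE, hNE, hE⟩ := exists_sup (B := Option V) hDu hNu
  obtain ⟨h₁, h₂, h₃⟩ := replaceAt_below hMt hu hD hEu hDE
  -- Merging `N` into `M` at `p` yields a top above the greatest top, so nothing changes and `E =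
  -- D`.
  have := below_antisymm h₂ (hmax _ (h𝕊.merge M hM N hN p hp D E hD hDE hNE hE) h₁)
  rw [← this, hD, Option.some.injEq] at h₃
  rwa [h₃]

/-- The condition on steps is stated for shapes only; it applies to `s` because a redex remains a
redex when all variables of `s` are collapsed to one. -/
theorem step_cases (h𝕊 : IsShapeSystem R 𝕊) {M : Shape F} {s t : F.Term A}
    (hM : IsGreatestTop 𝕊 M s) (h : Rew R s t) :
    (∃ N ∈ 𝕊, TopStep R M N s t) ∨ AlienStep R M s t := by
  obtain ⟨ρ, hρ, p, hst⟩ := rew_iff.1 h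
  by_cases hp : p ∈ funPositions M
  · obtain ⟨τ, hτ, rfl⟩ := hst
    have hτ' : subtermAt (s.relabel fun _ => ()) p =
        some (ρ.lhs.subst fun x => (τ x).relabel fun _ => ()) := by
      rw [← subst_relabel, subtermAt_relabel, hτ, Option.map_some]
    obtain ⟨σ, hσ, h'⟩ := h𝕊.step ρ hρ M _ p _ (isGreatestTop_relabel_iff.2 hM) hp hτ'
    exact .inl ⟨_, h', topStep_replaceAt hρ hM.2.1 hσ hτ⟩
  · exact .inr (alienStep_of_notMem hρ hM.2.1 hst hp)

end IsShapeSystem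

variable {R : TRS F V} {𝕊 : Set (Shape F)}

/-! ### Bounds for the rank -/

/-- The rank of the term is at most `n`, where variables have rank `0`: the term is a layer, up to
subterms of smaller rank in its holes. -/
def RankLE (𝕊 : Set (Shape F)) : ℕ → F.Term A → Prop
  | 0, t => ∃ a, t = .var a
  | n + 1, t => ∃ L ∈ 𝕊, Lift (fun _ => RankLE 𝕊 n) L t

theorem RankLE.succ (h𝕊 : IsShapeSystem R 𝕊) {n : ℕ} {t : F.Term A} (h : RankLE 𝕊 n t) :
    RankLE 𝕊 (n + 1) t := ⟨_, h𝕊.var_mem, .var h⟩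

theorem RankLE.mono (h𝕊 : IsShapeSystem R 𝕊) {m n : ℕ} (hmn : m ≤ n) {t : F.Term A}
    (h : RankLE 𝕊 m t) : RankLE 𝕊 n t := by
  induction hmn with
  | refl => exact h
  | step _ ih => exact ih.succ h𝕊

theorem rankLE_var (h𝕊 : IsShapeSystem R 𝕊) (n : ℕ) (a : A) :
    RankLE 𝕊 n (.var a : F.Term A) :=
  RankLE.mono h𝕊 (Nat.zero_le n) ⟨a, rfl⟩

theorem RankLE.relabel {n : ℕ} {t : F.Term A} (h : RankLE 𝕊 n t) (g : A → B) :
    RankLE 𝕊 n (t.relabel g) := by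
  induction n generalizing t with
  | zero =>
    obtain ⟨a, rfl⟩ := h
    exact ⟨g a, rfl⟩
  | succ n ih =>
    obtain ⟨L, hL, h⟩ := h
    exact ⟨L, hL, h.relabel g fun _ _ => ih⟩

/-- Every term headed by a function symbol has a nontrivial layer on top, so its rank exceeds that
of the contents of the holes. -/
theorem exists_rankLE (h𝕊 : IsShapeSystem R 𝕊) (t : F.Term A) : ∃ n, RankLE 𝕊 n t := by
  -- The aliens may sit deep inside `t`, so the induction bounds all subterms that can occur in the
  -- hole of some shape below `t`.
  suffices h : ∃ n, ∀ D : Shape F, Below D t → Lift (fun _ => RankLE 𝕊 n) D t by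
    obtain ⟨n, h⟩ := h
    exact ⟨n, (lift_var_iff (k := fun _ => RankLE 𝕊 n)).1 (h (.var ()) (below_var t))⟩
  induction t with
  | var a =>
    refine ⟨0, fun D hD => ?_⟩
    cases D with
    | var b => exact .var ⟨a, rfl⟩
    | func f Ds => obtain ⟨ts, ht, -⟩ := below_func_iff.1 hD; cases ht
  | func f ts ih =>
    choose n hn using ih
    have hmono : ∀ i, ∀ D : Shape F, Below D (ts i) →
        Lift (fun _ => RankLE 𝕊 (∑ i, n i)) D (ts i) := fun i D hD =>
      (hn i D hD).mono fun _ _ =>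
        RankLE.mono h𝕊 (Finset.single_le_sum (fun _ _ => Nat.zero_le _) (Finset.mem_univ i))
    obtain ⟨Ds, hDs, hD⟩ := h𝕊.exists_top f fun i => (ts i).relabel fun _ => ()
    have htop : RankLE 𝕊 ((∑ i, n i) + 1) (Term.func f ts) :=
      ⟨_, hDs, .func f fun i => hmono i _ (below_relabel_iff.1 (hD i))⟩
    refine ⟨(∑ i, n i) + 1, fun D hD => ?_⟩
    cases D with
    | var b => exact .var htop
    | func g Es =>
      obtain ⟨ts', ht, h⟩ := below_func_iff.1 hD
      cases ht
      exact .func f fun i => (hmono i _ (h i)).mono fun _ _ => RankLE.succ h𝕊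

/-- The holes of `M` lie at or below the holes of `L`. There `M` cuts the contents of the holes of
`L` along saturated shapes, for which `P` is inherited. -/
theorem lift_of_saturated {P : F.Term A → Prop}
    (hP : ∀ (M : Shape F) u, Saturated 𝕊 M u → P u → Lift (fun _ => P) M u) {L M : Shape F}
    {t : F.Term A} (hL : Lift (fun _ => P) L t) (hLM : Below L M) (hM : Saturated 𝕊 M t) :
    Lift (fun _ => P) M t := by
  induction L generalizing M t with
  | var a => exact hP M t hM (lift_var_iff.1 hL)
  | func f Ls ih =>
    obtain ⟨Ms, rfl, hMs⟩ := below_func_iff.1 hLM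
    obtain ⟨ts, rfl, -, hM⟩ := hM.exists_of_func
    rw [lift_func_func_iff] at hL
    exact .func f fun i => ih i (hL i) (hMs i) (hM i)

/-- In general a subterm may have larger rank than the term itself. In the holes of a saturated
shape this is excluded, since such a shape contains the layer that witnesses the bound. `M` need not
be in `𝕊`, so that the statement applies to the arguments of a greatest top. -/
theorem Saturated.lift_rankLE (h𝕊 : IsShapeSystem R 𝕊) {n : ℕ} {M : Shape F} {t : F.Term A}
    (hM : Saturated 𝕊 M t) (ht : RankLE 𝕊 n t) : Lift (fun _ => RankLE 𝕊 n) M t := by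
  induction n generalizing M t with
  | zero =>
    cases M with
    | var a => exact .var ht
    | func f Ms =>
      obtain ⟨a, rfl⟩ := ht
      obtain ⟨ts, h, -⟩ := hM.exists_of_func
      cases h
  | succ n ih =>
    cases M with
    | var a => exact .var ht
    | func f Ms =>
      obtain ⟨L, hL, ht⟩ := ht
      obtain ⟨ts, -, hmax, -⟩ := hM.exists_of_func
      exact (lift_of_saturated (fun M u h => ih h) ht (hmax L hL (below_of_lift ht)) hM).mono
        fun _ _ => RankLE.succ h𝕊

/-- A shape that is not just a hole strips off the uppermost layer, so the bound decreases strictly.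
-/
theorem Saturated.lift_rankLE_of_func (h𝕊 : IsShapeSystem R 𝕊) {m n : ℕ} {f : F.Functions m}
    {Ms : Fin m → Shape F} {t : F.Term A} (hM : Saturated 𝕊 (.func f Ms) t)
    (ht : RankLE 𝕊 (n + 1) t) : Lift (fun _ => RankLE 𝕊 n) (.func f Ms) t := by
  obtain ⟨L, hL, ht⟩ := ht
  obtain ⟨ts, -, hmax, -⟩ := hM.exists_of_func
  exact lift_of_saturated (fun M u h => h.lift_rankLE h𝕊) ht (hmax L hL (below_of_lift ht)) hM

/-- Layers with terms from a suitable set in the holes are closed under rewriting. -/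
theorem layered_of_rew (h𝕊 : IsShapeSystem R 𝕊) {P : F.Term A → Prop}
    (hP : ∀ (M : Shape F) u, Saturated 𝕊 M u → P u → Lift (fun _ => P) M u)
    (hP' : ∀ a b, P a → Rew R a b → P b) {s t : F.Term A}
    (hs : ∃ L ∈ 𝕊, Lift (fun _ => P) L s) (h : Rew R s t) : ∃ L ∈ 𝕊, Lift (fun _ => P) L t := by
  obtain ⟨L, hL, hs⟩ := hs
  have hM := h𝕊.maxTop_spec s
  have hs' := lift_of_saturated hP hs (hM.2.2 L hL (below_of_lift hs)) (h𝕊.saturated hM)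
  obtain ⟨N, hN, h⟩ | h := h𝕊.step_cases hM h
  · exact ⟨N, hN, h.lift hs'⟩
  · exact ⟨_, hM.1, h.lift hP' hs'⟩

theorem RankLE.rew (h𝕊 : IsShapeSystem R 𝕊) {n : ℕ} {s t : F.Term A} (hs : RankLE 𝕊 n s)
    (h : Rew R s t) : RankLE 𝕊 n t := by
  induction n generalizing s t with
  | zero =>
    obtain ⟨a, rfl⟩ := hs
    exact absurd h not_rew_var
  | succ n ih => exact layered_of_rew h𝕊 (fun M u h => h.lift_rankLE h𝕊) (fun _ _ => ih) hs h

theorem RankLE.rews (h𝕊 : IsShapeSystem R 𝕊) {n : ℕ} {s t : F.Term A} (hs : RankLE 𝕊 n s)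
    (h : ReflTransGen (Rew R) s t) : RankLE 𝕊 n t := by
  induction h with
  | refl => exact hs
  | tail _ h ih => exact ih.rew h𝕊 h

/-- The rewrite relation is confluent on the terms of rank at most `n`. -/
def ConfluentUpTo (R : TRS F V) (𝕊 : Set (Shape F)) (n : ℕ) (A : Type*) : Prop :=
  ∀ a b c : F.Term A, RankLE 𝕊 n a → ReflTransGen (Rew R) a b → ReflTransGen (Rew R) a c →
    ∃ d, ReflTransGen (Rew R) b d ∧ ReflTransGen (Rew R) c d

/-- Only finitely many variables occur in the peak. They can be renamed injectively into `B` and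
back, since rewriting creates no variables and renaming preserves the rank bound. This makes the
induction hypothesis available for terms with markers. -/
theorem ConfluentUpTo.transfer [Infinite B] [Nonempty A] {n : ℕ}
    (h : ConfluentUpTo R 𝕊 n B) : ConfluentUpTo R 𝕊 n A := by
  intro a b c ha hab hac
  obtain ⟨g, hg⟩ : ∃ g : A → B, Set.InjOn g (vars a) := by
    have := (vars_finite a).to_subtype
    have he := (Infinite.natEmbedding B).injective.comp
      (Fin.val_injective.comp (Finite.equivFin (vars a)).injective)
    set e := Infinite.natEmbedding B ∘ Fin.val ∘ Finite.equivFin (vars a)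
    classical
    refine ⟨fun x => if hx : x ∈ vars a then e ⟨x, hx⟩ else Classical.arbitrary B, ?_⟩
    intro x hx y hy hxy
    simp only [hx, hy, dif_pos] at hxy
    exact congrArg Subtype.val (he hxy)
  have hinv : ∀ t : F.Term A, vars t ⊆ vars a →
      (t.relabel g).relabel (Function.invFunOn g (vars a)) = t := by
    intro t ht
    rw [relabel_comp, relabel_eq_subst]
    conv_rhs => rw [← subst_var t]
    exact subst_congr fun x hx => congrArg _ (hg.leftInvOn_invFunOn (ht hx))
  obtain ⟨d, hbd, hcd⟩ := h _ _ _ (ha.relabel g) (rews_relabel hab g) (rews_relabel hac g)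
  have hbd := rews_relabel hbd (Function.invFunOn g (vars a))
  have hcd := rews_relabel hcd (Function.invFunOn g (vars a))
  rw [hinv _ (rews_vars_subset hab)] at hbd
  rw [hinv _ (rews_vars_subset hac)] at hcd
  exact ⟨_, hbd, hcd⟩

/-! ### Marked terms -/

/-- Replaces the markers `w : W` by terms. -/
def fill (τ : W → F.Term V) (C : F.Term (V ⊕ W)) : F.Term V := C.subst (Sum.elim .var τ)

theorem fill_func (τ : W → F.Term V) {n : ℕ} (f : F.Functions n) (Cs : Fin n → F.Term (V ⊕ W)) :
    fill τ (.func f Cs) = .func f fun i => fill τ (Cs i) := rfl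

theorem fill_inl (τ : W → F.Term V) (t : F.Term V) : fill τ (t.relabel Sum.inl) = t := by
  rw [fill, relabel_subst]
  exact subst_var t

theorem fill_relabel {W' : Type*} (τ : W' → F.Term V) (g : W → W') (C : F.Term (V ⊕ W)) :
    fill τ (C.relabel (Sum.map id g)) = fill (fun w => τ (g w)) C := by
  rw [fill, relabel_subst, fill]
  congr 1
  funext a
  cases a <;> rfl

theorem rews_fill {τ : W → F.Term V} {C C' : F.Term (V ⊕ W)} (h : ReflTransGen (Rew R) C C') :
    ReflTransGen (Rew R) (fill τ C) (fill τ C') := rews_subst h _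

theorem rews_fill_of_forall {τ τ' : W → F.Term V} (h : ∀ w, ReflTransGen (Rew R) (τ w) (τ' w))
    (C : F.Term (V ⊕ W)) : ReflTransGen (Rew R) (fill τ C) (fill τ' C) := by
  refine rews_subst_of_forall C fun a => ?_
  cases a with
  | inl x => exact .refl
  | inr w => exact h w

theorem eq_of_relabel_eq_inl {W' : Type*} {g : W → W'} {C : F.Term (V ⊕ W)} {t : F.Term V}
    (h : C.relabel (Sum.map id g) = t.relabel Sum.inl) : C = t.relabel Sum.inl := by
  induction C generalizing t with
  | var a =>
    cases t with
    | var x =>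
      cases a with
      | inl y => simpa using h
      | inr w => simp at h
    | func f ts => simp at h
  | func f Cs ih =>
    cases t with
    | var x => simp at h
    | func f' ts =>
      simp only [Term.relabel, Term.func.injEq] at h
      obtain ⟨rfl, hf, h⟩ := h
      obtain rfl := eq_of_heq hf
      have h := eq_of_heq h
      simp only [Term.relabel]
      congr 1
      funext i
      exact ih i (congrFun h i)

theorem rew_inl [Nonempty V] (hR : LeftLinear R) {t : F.Term V} {C : F.Term (V ⊕ W)}
    (h : Rew R (t.relabel Sum.inl) C) : ∃ t', Rew R t t' ∧ C = t'.relabel Sum.inl := by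
  -- Removing the embedding is an instance of `Lift`, so the step can be projected to `t`; the
  -- relation is empty at markers, so none can occur in `C`.
  have key : Lift (Sum.elim (fun x u => u = Term.var x) fun (_ : W) _ => False)
      (t.relabel Sum.inl) t := by
    clear h
    induction t with
    | var x => exact .var rfl
    | func f ts ih => exact .func f ih
  obtain ⟨t', ht, hC⟩ := key.rew hR h
  refine ⟨t', ht, ?_⟩
  clear h ht key
  induction hC with
  | var h =>
    rename_i a _
    cases a with
    | inl x => rw [h]; rfl
    | inr w => exact h.elim
  | func f _ ih => simp only [Term.relabel, ← ih]

/-- Contents of the holes of a base: markers, and terms of rank at most `m` without markers. -/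
def IsBaseArg (𝕊 : Set (Shape F)) (m : ℕ) (C : F.Term (V ⊕ W)) : Prop :=
  (∃ w, C = .var (.inr w)) ∨ ∃ u : F.Term V, RankLE 𝕊 m u ∧ C = u.relabel Sum.inl

/-- A layer with markers, and terms of rank at most `m` without markers, in the holes. -/
def IsBase (𝕊 : Set (Shape F)) (m : ℕ) (C : F.Term (V ⊕ W)) : Prop :=
  ∃ L ∈ 𝕊, Lift (fun _ => IsBaseArg 𝕊 m) L C

/-- Markers are variables, of rank `0`, so marking has removed everything of rank larger than `m`
below the layer. The induction hypothesis thus applies to bases. -/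
theorem IsBase.rankLE (h𝕊 : IsShapeSystem R 𝕊) {m : ℕ} {C : F.Term (V ⊕ W)}
    (h : IsBase 𝕊 m C) : RankLE 𝕊 (m + 1) C := by
  obtain ⟨L, hL, h⟩ := h
  refine ⟨L, hL, h.mono fun _ C hC => ?_⟩
  obtain ⟨w, rfl⟩ | ⟨u, hu, rfl⟩ := hC
  · exact rankLE_var h𝕊 m _
  · exact hu.relabel _

theorem IsBase.rew [Nonempty V] (h𝕊 : IsShapeSystem R 𝕊) (hR : LeftLinear R) {m : ℕ}
    {C D : F.Term (V ⊕ W)} (h : IsBase 𝕊 m C) (hCD : Rew R C D) : IsBase 𝕊 m D := by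
  refine layered_of_rew h𝕊 (fun M C hM hC => ?_) (fun C D hC hCD => ?_) h hCD
  · obtain ⟨w, rfl⟩ | ⟨u, hu, rfl⟩ := hC
    · cases M with
      | var a => exact .var (.inl ⟨w, rfl⟩)
      | func f Ms => obtain ⟨ts, h, -⟩ := hM.exists_of_func; cases h
    · exact (hM.of_relabel.lift_rankLE h𝕊 hu).relabel _ fun _ u hu => .inr ⟨u, hu, rfl⟩
  · obtain ⟨w, rfl⟩ | ⟨u, hu, rfl⟩ := hC
    · exact absurd hCD not_rew_var
    · obtain ⟨u', hu', rfl⟩ := rew_inl hR hCD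
      exact .inr ⟨u', hu.rew h𝕊 hu', rfl⟩

theorem IsBase.rews [Nonempty V] (h𝕊 : IsShapeSystem R 𝕊) (hR : LeftLinear R) {m : ℕ}
    {C D : F.Term (V ⊕ W)} (h : IsBase 𝕊 m C) (hCD : ReflTransGen (Rew R) C D) :
    IsBase 𝕊 m D := by
  induction hCD with
  | refl => exact h
  | tail _ h ih => exact ih.rew h𝕊 hR h

theorem IsBase.of_relabel {W' : Type*} {m : ℕ} {g : W → W'} {C : F.Term (V ⊕ W)}
    (h : IsBase 𝕊 m (C.relabel (Sum.map id g))) : IsBase 𝕊 m C := by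
  obtain ⟨L, hL, h⟩ := h
  refine ⟨L, hL, ?_⟩
  clear hL
  induction L generalizing C with
  | var a =>
    refine .var ?_
    obtain ⟨w, h⟩ | ⟨u, hu, h⟩ := lift_var_iff.1 h
    · cases C with
      | var a =>
        cases a with
        | inl x => simp at h
        | inr w => exact .inl ⟨w, rfl⟩
      | func f Cs => simp at h
    · exact .inr ⟨u, hu, eq_of_relabel_eq_inl h⟩
  | func f Ls ih =>
    cases C with
    | var a => obtain ⟨ts, h, -⟩ := lift_func_iff.1 h; simp at h
    | func f' Cs =>
      obtain ⟨ts, ht, h⟩ := lift_func_iff.1 h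
      simp only [Term.relabel, Term.func.injEq] at ht
      obtain ⟨rfl, hf, ht⟩ := ht
      obtain rfl := eq_of_heq hf
      obtain rfl := eq_of_heq ht
      exact .func _ fun i => ih i (h i)

open Classical in
/-- Replaces the subterms in the holes of `M` whose rank is larger than `m` by markers. -/
noncomputable def mark (𝕊 : Set (Shape F)) (m : ℕ) : Shape F → F.Term V → F.Term (V ⊕ F.Term V)
  | .var _, t => if RankLE 𝕊 m t then t.relabel Sum.inl else .var (.inr t)
  | .func _ _, .var x => .var (.inl x)
  | @Term.func _ _ n _ Ms, .func g ts =>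
      .func g fun i => if h : (i : ℕ) < n then mark 𝕊 m (Ms ⟨i, h⟩) (ts i)
        else (ts i).relabel Sum.inl

theorem mark_func (m : ℕ) {n : ℕ} (f g : F.Functions n) (Ms : Fin n → Shape F)
    (ts : Fin n → F.Term V) :
    mark 𝕊 m (.func f Ms) (.func g ts) = .func g fun i => mark 𝕊 m (Ms i) (ts i) := by
  simp [mark]

theorem fill_mark (m : ℕ) (M : Shape F) (t : F.Term V) : fill id (mark 𝕊 m M t) = t := by
  induction M generalizing t with
  | var a =>
    simp only [mark]
    split_ifs
    · exact fill_inl _ t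
    · rfl
  | func f Ms ih =>
    cases t with
    | var x => simp [mark, fill, Term.subst]
    | func g ts =>
      simp only [mark, fill_func]
      congr 1
      funext i
      split_ifs with h
      · exact ih ⟨i, h⟩ (ts i)
      · exact fill_inl _ _

theorem mark_subst (m : ℕ) (t : F.Term V) (σ : V → Shape F) (τ : V → F.Term V) :
    mark 𝕊 m (t.subst σ) (t.subst τ) = t.subst fun x => mark 𝕊 m (σ x) (τ x) := by
  induction t with
  | var x => rfl
  | func f ts ih => simp only [Term.subst, mark_func, ih]

/-- The result marks `t` along `N`, which is a layer but need not be the greatest top of `t`; hence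
short steps do not require their result to be a base. -/
theorem TopStep.mark {M N : Shape F} {s t : F.Term V} (h : TopStep R M N s t) (m : ℕ) :
    Rew R (mark 𝕊 m M s) (mark 𝕊 m N t) := by
  induction h with
  | root hρ σ τ =>
    rw [mark_subst, mark_subst]
    exact .root hρ _
  | arg f Ms ts i _ ih =>
    rw [mark_func, mark_func]
    convert Rew.arg f (fun j => Rewriting.mark 𝕊 m (Ms j) (ts j)) i ih using 2
    funext j
    by_cases hj : j = i
    · subst hj; simp
    · simp [hj]

theorem isBase_mark {M : Shape F} (hM : M ∈ 𝕊) {t : F.Term V} (hMt : Below M t) (m : ℕ) :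
    IsBase 𝕊 m (mark 𝕊 m M t) := by
  refine ⟨M, hM, ?_⟩
  clear hM
  induction M generalizing t with
  | var a =>
    refine .var ?_
    simp only [mark]
    split_ifs with h
    · exact .inr ⟨t, h, rfl⟩
    · exact .inl ⟨t, rfl⟩
  | func f Ms ih =>
    obtain ⟨ts, rfl, h⟩ := below_func_iff.1 hMt
    rw [mark_func]
    exact .func f fun i => ih i (h i)

theorem mark_eq_inl {m : ℕ} {M : Shape F} {t : F.Term V}
    (h : Lift (fun _ => RankLE 𝕊 m) M t) : mark 𝕊 m M t = t.relabel Sum.inl := by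
  induction h with
  | var h => simp only [mark, if_pos h]
  | func f _ ih => simp only [mark_func, ih, Term.relabel]

/-- The marked term `C'` arises from a marked term by replacing markers `w` by marked terms that
stand for `τ w`, and these are markers or free of markers if the rank of `τ w` is at most
`m + 1`. -/
def Refines (𝕊 : Set (Shape F)) (m : ℕ) (τ : W → F.Term V) :
    V ⊕ W → F.Term (V ⊕ F.Term V) → Prop :=
  Sum.elim (fun x C => C = .var (.inl x)) fun w C => fill id C = τ w ∧
    (RankLE 𝕊 (m + 1) (τ w) → C = .var (.inr (τ w)) ∨ C = (τ w).relabel Sum.inl)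

/-- The layer of `C` is a top of `fill τ C`, hence below `M`. At a marker `w` the shape `M` is
either a hole, and `τ w` is treated as a whole, or it extends into `τ w`; in the latter case, if `τ
w` has rank at most `m + 1`, what is left in the holes has rank at most `m` and is not marked. -/
theorem IsBase.lift_mark (h𝕊 : IsShapeSystem R 𝕊) {m : ℕ} {C : F.Term (V ⊕ W)}
    (hC : IsBase 𝕊 m C) (τ : W → F.Term V) {M : Shape F} (hM : IsGreatestTop 𝕊 M (fill τ C)) :
    Lift (Refines 𝕊 m τ) C (mark 𝕊 m M (fill τ C)) := by
  obtain ⟨L, hL, hC⟩ := hC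
  have hLM : Below L M := by
    refine hM.2.2 L hL ?_
    clear hL hM
    induction hC with
    | var h => exact .var trivial
    | func f _ ih => exact .func f fun i => ih i
  have hM' := h𝕊.saturated hM
  clear hM hL
  induction L generalizing C M with
  | var a =>
    obtain ⟨w, rfl⟩ | ⟨u, hu, rfl⟩ := lift_var_iff.1 hC
    · refine .var ⟨fill_mark m M _, fun hw => ?_⟩
      change Rewriting.mark 𝕊 m M (τ w) = _ ∨ Rewriting.mark 𝕊 m M (τ w) = _
      cases M with
      | var a =>
        simp only [mark]
        split_ifs <;> simp
      | func f Ms => exact .inr (mark_eq_inl (hM'.lift_rankLE_of_func h𝕊 hw))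
    · rw [fill_inl] at hM' ⊢
      rw [mark_eq_inl (hM'.lift_rankLE h𝕊 hu)]
      clear hu hM' hC
      induction u with
      | var x => exact .var rfl
      | func f ts ih => exact .func f ih
  | func f Ls ih =>
    obtain ⟨Ms, rfl, hMs⟩ := below_func_iff.1 hLM
    obtain ⟨Cs, rfl, hCs⟩ := lift_func_iff.1 hC
    rw [fill_func] at hM' ⊢
    obtain ⟨ts, h, -, hM'⟩ := hM'.exists_of_func
    cases h
    rw [mark_func]
    exact .func f fun i => ih i (hCs i) (hMs i) (hM' i)

theorem fill_eq_of_refines {m : ℕ} {τ : W → F.Term V} {C : F.Term (V ⊕ W)}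
    {C' : F.Term (V ⊕ F.Term V)} (h : Lift (Refines 𝕊 m τ) C C') : fill id C' = fill τ C := by
  induction h with
  | var h =>
    rename_i a _
    cases a with
    | inl x => rw [show _ = _ from h]; rfl
    | inr w => exact h.1
  | func f _ ih => simp only [fill_func, ih]

/-! ### Confluence of a union of two relations -/

/-- By `hrefl`, reflexivity of `T` is needed only where an `S` step starts; for tall steps it holds
only up to a bounded rank. -/
theorem confluent_of_diagrams {S T : A → A → Prop} (hrefl : ∀ a b, S a b → T a a)
    (hS : ∀ a b c, S a b → S a c → ∃ d, S b d ∧ S c d)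
    (hTS : ∀ a b c, T a b → S a c → ∃ d e, S b d ∧ T c e ∧ S e d)
    (hT : ∀ a b c, T a b → T a c → ∃ d e e', T b e ∧ S e d ∧ T c e' ∧ S e' d) :
    Confluent fun a b => S a b ∨ T a b := by
  have hSs : ∀ a b c, S a b → ReflTransGen S a c → ∃ d, ReflTransGen S b d ∧ S c d := by
    intro a b c hab hac
    induction hac with
    | refl => exact ⟨b, .refl, hab⟩
    | tail _ h ih =>
      obtain ⟨d, hbd, hcd⟩ := ih
      obtain ⟨e, hde, hce⟩ := hS _ _ _ hcd h
      exact ⟨e, hbd.tail hde, hce⟩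
  have hSS : ∀ a b c, ReflTransGen S a b → ReflTransGen S a c →
      ∃ d, ReflTransGen S b d ∧ ReflTransGen S c d := by
    intro a b c hab hac
    induction hab with
    | refl => exact ⟨c, hac, .refl⟩
    | tail _ h ih =>
      obtain ⟨d, hbd, hcd⟩ := ih
      obtain ⟨e, hbe, hde⟩ := hSs _ _ _ h hbd
      exact ⟨e, hbe, hcd.tail hde⟩
  have hTSs : ∀ a b c, T a b → ReflTransGen S a c →
      ∃ d e, ReflTransGen S b d ∧ T c e ∧ ReflTransGen S e d := by
    intro a b c hab hac
    induction hac with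
    | refl => exact ⟨b, b, .refl, hab, .refl⟩
    | tail _ h ih =>
      obtain ⟨d, e, hbd, hce, hed⟩ := ih
      obtain ⟨d', e', hed', hce', hd'⟩ := hTS _ _ _ hce h
      obtain ⟨g, hg, hg'⟩ := hSs _ _ _ hed' hed
      exact ⟨g, e', hbd.tail hg', hce', .head hd' hg⟩
  -- One `T` step followed by `S` steps has the diamond property, and `Q` lies between the union of
  -- `S` and `T` and its reflexive transitive closure.
  let Q : A → A → Prop := fun a c => ∃ b, T a b ∧ ReflTransGen S b c
  have hQ : ∀ a b c, Q a b → Q a c → ∃ d, Q b d ∧ Q c d := by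
    rintro a b c ⟨b₀, hab, hb⟩ ⟨c₀, hac, hc⟩
    obtain ⟨d, x, y, hx, hxd, hy, hyd⟩ := hT _ _ _ hab hac
    obtain ⟨p, x', hp, hx', hxp⟩ := hTSs _ _ _ hx hb
    obtain ⟨q, y', hq, hy', hyq⟩ := hTSs _ _ _ hy hc
    obtain ⟨p', hp', hdp⟩ := hSS _ _ _ hp (.single hxd)
    obtain ⟨q', hq', hdq⟩ := hSS _ _ _ hq (.single hyd)
    obtain ⟨z, hz, hz'⟩ := hSS _ _ _ hdp hdq
    exact ⟨z, ⟨x', hx', hxp.trans (hp'.trans hz)⟩, ⟨y', hy', hyq.trans (hq'.trans hz')⟩⟩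
  have hto : ∀ a b, ReflTransGen (fun a b => S a b ∨ T a b) a b → ReflTransGen Q a b := by
    intro a b h
    refine h.lift id ?_
    rintro a b (h | h)
    · exact ⟨a, hrefl a b h, .single h⟩
    · exact ⟨b, h, .refl⟩
  have hof : ∀ a b, ReflTransGen Q a b → ReflTransGen (fun a b => S a b ∨ T a b) a b := by
    intro a b h
    induction h with
    | refl => exact .refl
    | tail _ h ih =>
      obtain ⟨c, hac, hcb⟩ := h
      exact (ih.tail (.inr hac)).trans (hcb.lift id fun _ _ h => .inl h)
  intro a b c hab hac
  obtain ⟨d, hbd, hcd⟩ := church_rosser (fun a b c hab hac => by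
    obtain ⟨d, hbd, hcd⟩ := hQ a b c hab hac
    exact ⟨d, .single hbd, .single hcd⟩) (hto _ _ hab) (hto _ _ hac)
  exact ⟨d, hof _ _ hbd, hof _ _ hcd⟩

/-! ### Short and tall steps -/

/-- The base of a term: the aliens of rank larger than `m` are replaced by markers. -/
noncomputable def IsShapeSystem.base (h𝕊 : IsShapeSystem R 𝕊) (m : ℕ) (t : F.Term V) :
    F.Term (V ⊕ F.Term V) := mark 𝕊 m (h𝕊.maxTop t) t

/-- Short steps rewrite the base of a term. -/
def Short (h𝕊 : IsShapeSystem R 𝕊) (m : ℕ) (s t : F.Term V) : Prop :=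
  RankLE 𝕊 (m + 2) s ∧ ∃ C, ReflTransGen (Rew R) (h𝕊.base m s) C ∧ t = fill id C

/-- Rewrite sequences that start in terms of rank at most `m + 1`. -/
abbrev TallSeq (R : TRS F V) (𝕊 : Set (Shape F)) (m : ℕ) :=
  {p : F.Term V × F.Term V // RankLE 𝕊 (m + 1) p.1 ∧ ReflTransGen (Rew R) p.1 p.2}

/-- Tall steps rewrite the aliens of rank larger than `m` in parallel. -/
def Tall (h𝕊 : IsShapeSystem R 𝕊) (m : ℕ) (s t : F.Term V) : Prop :=
  RankLE 𝕊 (m + 2) s ∧ ∃ C : F.Term (V ⊕ TallSeq R 𝕊 m),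
    C.relabel (Sum.map id fun q => q.1.1) = h𝕊.base m s ∧ t = fill (fun q => q.1.2) C

variable {m : ℕ}

theorem isBase_base (h𝕊 : IsShapeSystem R 𝕊) (m : ℕ) (t : F.Term V) : IsBase 𝕊 m (h𝕊.base m t) :=
  isBase_mark (h𝕊.maxTop_spec t).1 (h𝕊.maxTop_spec t).2.1 m

theorem fill_base (h𝕊 : IsShapeSystem R 𝕊) (m : ℕ) (t : F.Term V) : fill id (h𝕊.base m t) = t := fill_mark m _ t

theorem IsBase.lift_base (h𝕊 : IsShapeSystem R 𝕊) {C : F.Term (V ⊕ W)} (hC : IsBase 𝕊 m C) (τ : W → F.Term V) :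
    Lift (Refines 𝕊 m τ) C (h𝕊.base m (fill τ C)) :=
  hC.lift_mark h𝕊 τ (h𝕊.maxTop_spec _)

theorem Short.rews (h𝕊 : IsShapeSystem R 𝕊) {s t : F.Term V} (h : Short h𝕊 m s t) : ReflTransGen (Rew R) s t := by
  obtain ⟨-, C, hC, rfl⟩ := h
  have := rews_fill (τ := id) hC
  rwa [fill_base] at this

theorem Tall.rews (h𝕊 : IsShapeSystem R 𝕊) {s t : F.Term V} (h : Tall h𝕊 m s t) : ReflTransGen (Rew R) s t := by
  obtain ⟨-, C, hC, rfl⟩ := h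
  have h' := fill_base h𝕊 m s
  rw [← hC, fill_relabel] at h'
  conv_lhs => rw [← h']
  exact rews_fill_of_forall (fun q => q.2.2) C

/-- A rewrite sequence from a base lifts to a short step. -/
theorem IsBase.short (h𝕊 : IsShapeSystem R 𝕊) [Nonempty V] (hR : LeftLinear R) {C D : F.Term (V ⊕ W)}
    (hC : IsBase 𝕊 m C) {τ : W → F.Term V} (hr : RankLE 𝕊 (m + 2) (fill τ C))
    (h : ReflTransGen (Rew R) C D) : Short h𝕊 m (fill τ C) (fill τ D) := by
  obtain ⟨E, hE, hDE⟩ := (hC.lift_base h𝕊 τ).rews hR h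
  exact ⟨hr, E, hE, (fill_eq_of_refines hDE).symm⟩

/-- Aliens that are still markers in the actual base of `fill τ C` are rewritten by the tall step.
The others are free of markers there, so the short step rewrites them afterwards. -/
theorem IsBase.tall_short (h𝕊 : IsShapeSystem R 𝕊) [Nonempty V] (hR : LeftLinear R) {C : F.Term (V ⊕ W)}
    (hC : IsBase 𝕊 m C) {τ τ' : W → F.Term V}
    (hτ : ∀ w, RankLE 𝕊 (m + 1) (τ w) ∧ ReflTransGen (Rew R) (τ w) (τ' w))
    (hr : RankLE 𝕊 (m + 2) (fill τ C)) :
    ∃ t, Tall h𝕊 m (fill τ C) t ∧ Short h𝕊 m t (fill τ' C) := by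
  -- `E` is the actual base with its markers named by `w`; in `E'` the aliens without a marker have
  -- been rewritten.
  obtain ⟨E, E', hE, hEE', hE'⟩ : ∃ E E' : F.Term (V ⊕ W),
      E.relabel (Sum.map id τ) = h𝕊.base m (fill τ C) ∧ ReflTransGen (Rew R) E E' ∧
        fill τ' E' = fill τ' C := by
    have := hC.lift_base h𝕊 τ
    generalize h𝕊.base m (fill τ C) = B at this
    clear hr hC
    induction this with
    | var h =>
      rename_i a B
      cases a with
      | inl x => exact ⟨.var (.inl x), .var (.inl x), h.symm, .refl, rfl⟩
      | inr w =>
        obtain rfl | rfl := h.2 (hτ w).1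
        · exact ⟨.var (.inr w), .var (.inr w), rfl, .refl, rfl⟩
        · refine ⟨(τ w).relabel Sum.inl, (τ' w).relabel Sum.inl, ?_,
            rews_relabel (hτ w).2 _, fill_inl _ _⟩
          rw [relabel_comp]
          rfl
    | func f _ ih =>
      choose E E' h₁ h₂ h₃ using ih
      exact ⟨.func f E, .func f E', by simp only [Term.relabel, h₁], rews_func f h₂,
        by simp only [fill_func, h₃]⟩
  have ht : Tall h𝕊 m (fill τ C) (fill τ' E) := by
    refine ⟨hr, E.relabel (Sum.map id fun w => ⟨(τ w, τ' w), hτ w⟩), ?_, ?_⟩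
    · rw [relabel_comp, ← hE]
      congr 1
      funext a
      cases a <;> rfl
    · rw [fill_relabel]
  have hbase : IsBase 𝕊 m E := by
    refine IsBase.of_relabel (g := τ) ?_
    rw [hE]
    exact isBase_base h𝕊 m _
  refine ⟨_, ht, ?_⟩
  rw [← hE']
  exact hbase.short h𝕊 hR (hr.rews h𝕊 (ht.rews h𝕊)) hEE'

theorem Tall.refl_of_lift {M : Shape F} {s : F.Term V}
    (h : Lift (fun _ => RankLE 𝕊 (m + 1)) M s) : ∃ C : F.Term (V ⊕ TallSeq R 𝕊 m),
      C.relabel (Sum.map id fun q => q.1.1) = mark 𝕊 m M s ∧ fill (fun q => q.1.2) C = s := by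
  induction h with
  | var h =>
    rename_i a t
    by_cases ht : RankLE 𝕊 m t
    · refine ⟨t.relabel Sum.inl, ?_, fill_inl _ t⟩
      simp only [mark, if_pos ht]
      rw [relabel_comp]
      rfl
    · exact ⟨.var (.inr ⟨(t, t), h, .refl⟩), by simp [mark, if_neg ht], rfl⟩
  | func f _ ih =>
    choose C h₁ h₂ using ih
    exact ⟨.func f C, by simp only [Term.relabel, h₁, mark_func], by simp only [fill_func, h₂]⟩

theorem lift_maxTop (h𝕊 : IsShapeSystem R 𝕊) {s : F.Term V} {n : ℕ} (hs : RankLE 𝕊 (n + 1) s) :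
    Lift (fun _ => RankLE 𝕊 n) (h𝕊.maxTop s) s := by
  obtain ⟨L, hL, hs⟩ := hs
  have hM := h𝕊.maxTop_spec s
  exact lift_of_saturated (fun M u h => h.lift_rankLE h𝕊) hs (hM.2.2 L hL (below_of_lift hs))
    (h𝕊.saturated hM)

theorem Tall.refl (h𝕊 : IsShapeSystem R 𝕊) {s : F.Term V} (hs : RankLE 𝕊 (m + 2) s) : Tall h𝕊 m s s := by
  obtain ⟨C, h₁, h₂⟩ := Tall.refl_of_lift (lift_maxTop h𝕊 hs)
  exact ⟨hs, C, h₁, h₂.symm⟩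

/-- An alien of rank at most `m` is part of the base, so rewriting it is short; any other alien is a
marker, and rewriting it is tall. -/
theorem AlienStep.short_or_tall {M : Shape F} {s t : F.Term V} (h : AlienStep R M s t)
    (hs : Lift (fun _ => RankLE 𝕊 (m + 1)) M s) :
    (∃ C, ReflTransGen (Rew R) (mark 𝕊 m M s) C ∧ t = fill id C) ∨
      ∃ C : F.Term (V ⊕ TallSeq R 𝕊 m), C.relabel (Sum.map id fun q => q.1.1) = mark 𝕊 m M s ∧
        t = fill (fun q => q.1.2) C := by
  induction h with
  | var h =>
    rename_i s t
    by_cases hm : RankLE 𝕊 m s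
    · left
      simp only [mark, if_pos hm]
      exact ⟨t.relabel Sum.inl, .single (h.relabel _), (fill_inl _ t).symm⟩
    · right
      exact ⟨.var (.inr ⟨(s, t), (lift_var_iff (k := fun _ => RankLE 𝕊 (m + 1))).1 hs, .single h⟩), by simp [mark, if_neg hm], rfl⟩
  | arg f Ms ts i _ ih =>
    rw [lift_func_func_iff] at hs
    obtain ⟨C, h₁, h₂⟩ | ⟨C, h₁, h₂⟩ := ih (hs i)
    · left
      refine ⟨.func f (Function.update (fun j => mark 𝕊 m (Ms j) (ts j)) i C), ?_, ?_⟩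
      · rw [mark_func]
        exact rews_arg f _ i h₁
      · rw [fill_func]
        congr 1
        funext j
        by_cases hj : j = i
        · subst hj; simpa
        · simp [hj, fill_mark]
    · right
      choose D h₃ h₄ using fun j => Tall.refl_of_lift (hs j)
      refine ⟨.func f (Function.update D i C), ?_, ?_⟩
      · rw [mark_func, Term.relabel]
        congr 1
        funext j
        by_cases hj : j = i
        · subst hj; simpa
        · simp [hj, h₃]
      · rw [fill_func]
        congr 1
        funext j
        by_cases hj : j = i
        · subst hj; simpa
        · simp [hj, h₄]

theorem short_or_tall_of_rew (h𝕊 : IsShapeSystem R 𝕊) {s t : F.Term V} (hs : RankLE 𝕊 (m + 2) s) (h : Rew R s t) :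
    Short h𝕊 m s t ∨ Tall h𝕊 m s t := by
  obtain ⟨N, hN, h⟩ | h := h𝕊.step_cases (h𝕊.maxTop_spec s) h
  · exact .inl ⟨hs, _, .single (h.mark m), (fill_mark m N t).symm⟩
  · obtain h | h := h.short_or_tall (lift_maxTop h𝕊 hs)
    · exact .inl ⟨hs, h⟩
    · exact .inr ⟨hs, h⟩

theorem short_short (h𝕊 : IsShapeSystem R 𝕊) [Infinite V] (hR : LeftLinear R) (hconf : ConfluentUpTo R 𝕊 (m + 1) V)
    {s t t' : F.Term V} (h : Short h𝕊 m s t) (h' : Short h𝕊 m s t') :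
    ∃ d, Short h𝕊 m t d ∧ Short h𝕊 m t' d := by
  have hrt := h.1.rews h𝕊 (h.rews h𝕊)
  have hrt' := h.1.rews h𝕊 (h'.rews h𝕊)
  obtain ⟨-, C, hC, rfl⟩ := h
  obtain ⟨-, C', hC', rfl⟩ := h'
  have hb := isBase_base h𝕊 m s
  obtain ⟨D, hD, hD'⟩ := hconf.transfer _ _ _ (hb.rankLE h𝕊) hC hC'
  exact ⟨fill id D, (hb.rews h𝕊 hR hC).short h𝕊 hR hrt hD,
    (hb.rews h𝕊 hR hC').short h𝕊 hR hrt' hD'⟩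

theorem tall_short (h𝕊 : IsShapeSystem R 𝕊) [Infinite V] (hR : LeftLinear R) {s t t' : F.Term V} (h : Tall h𝕊 m s t)
    (h' : Short h𝕊 m s t') : ∃ d e, Short h𝕊 m t d ∧ Tall h𝕊 m t' e ∧ Short h𝕊 m e d := by
  have hrt := h.1.rews h𝕊 (h.rews h𝕊)
  have hrt' := h.1.rews h𝕊 (h'.rews h𝕊)
  obtain ⟨-, C, hC, rfl⟩ := h
  obtain ⟨-, D, hD, rfl⟩ := h'
  have hb : IsBase 𝕊 m C := .of_relabel (hC ▸ isBase_base h𝕊 m s)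
  rw [← hC] at hD
  obtain ⟨C', hCC', hC'⟩ : ∃ C', ReflTransGen (Rew R) C C' ∧
      C'.relabel (Sum.map id fun q => q.1.1) = D := by
    -- Equal markers of the base of `s` may carry different sequences in `C`. Left-linearity allows
    -- the rewriting of the base to be repeated with the sequences attached.
    have : Lift (fun a c => ∃ b, c = Term.var b ∧ a = Sum.map id (fun q => q.1.1) b)
        (C.relabel (Sum.map id fun q => q.1.1)) C := by
      clear hb hD hC hrt
      induction C with
      | var a => exact .var ⟨a, rfl, rfl⟩
      | func f Cs ih => exact .func f ih
    obtain ⟨C', hCC', hC'⟩ := this.rews hR hD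
    refine ⟨C', hCC', ?_⟩
    clear hD hCC' hrt' this
    induction hC' with
    | var h => obtain ⟨b, rfl, rfl⟩ := h; rfl
    | func f _ ih => simp only [Term.relabel, ih]
  subst hC'
  rw [fill_relabel] at hrt' ⊢
  obtain ⟨e, he, hed⟩ := (hb.rews h𝕊 hR hCC').tall_short h𝕊 hR (fun q => q.2) hrt'
  exact ⟨_, e, hb.short h𝕊 hR hrt hCC', he, hed⟩

theorem tall_tall (h𝕊 : IsShapeSystem R 𝕊) [Infinite V] (hR : LeftLinear R) (hconf : ConfluentUpTo R 𝕊 (m + 1) V)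
    {s t t' : F.Term V} (h : Tall h𝕊 m s t) (h' : Tall h𝕊 m s t') :
    ∃ d e e', Tall h𝕊 m t e ∧ Short h𝕊 m e d ∧ Tall h𝕊 m t' e' ∧ Short h𝕊 m e' d := by
  have hrt := h.1.rews h𝕊 (h.rews h𝕊)
  have hrt' := h.1.rews h𝕊 (h'.rews h𝕊)
  obtain ⟨-, C, hC, rfl⟩ := h
  obtain ⟨-, C', hC', rfl⟩ := h'
  have hb : IsBase 𝕊 m C := .of_relabel (hC ▸ isBase_base h𝕊 m s)
  -- Both tall steps start from the same base, so every marker can be labelled with the pair of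
  -- sequences applied to it, which is then joined by the induction hypothesis.
  obtain ⟨E, hE, hE'⟩ : ∃ E : F.Term (V ⊕ {p : TallSeq R 𝕊 m × TallSeq R 𝕊 m //
      p.1.1.1 = p.2.1.1}), E.relabel (Sum.map id fun p => p.1.1) = C ∧
        E.relabel (Sum.map id fun p => p.1.2) = C' := by
    have h := hC.trans hC'.symm
    clear hC hC' hrt hrt' hb
    induction C generalizing C' with
    | var a =>
      cases C' with
      | var b =>
        cases a <;> cases b <;> simp at h
        · subst h
          rename_i x
          exact ⟨.var (.inl x), rfl, rfl⟩
        · rename_i q q'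
          exact ⟨.var (.inr ⟨(q, q'), h⟩), rfl, rfl⟩
      | func f ts => simp at h
    | func f Cs ih =>
      cases C' with
      | var b => simp at h
      | func f' Cs' =>
        simp only [Term.relabel, Term.func.injEq] at h
        obtain ⟨rfl, hf, h⟩ := h
        obtain rfl := eq_of_heq hf
        have h := eq_of_heq h
        choose E h₁ h₂ using fun i => ih i (Cs' i) (congrFun h i)
        exact ⟨.func f E, by simp only [Term.relabel, h₁], by simp only [Term.relabel, h₂]⟩
  subst hE hE'
  have hb := hb.of_relabel
  have hjoin : ∀ p : {p : TallSeq R 𝕊 m × TallSeq R 𝕊 m // p.1.1.1 = p.2.1.1},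
      ∃ d, ReflTransGen (Rew R) p.1.1.1.2 d ∧ ReflTransGen (Rew R) p.1.2.1.2 d := by
    rintro ⟨⟨⟨⟨a, b⟩, ha, hab⟩, ⟨⟨a', c⟩, ha', hac⟩⟩, h⟩
    obtain rfl : a = a' := h
    exact hconf a b c ha hab hac
  choose τ hτ hτ' using hjoin
  rw [fill_relabel] at hrt hrt' ⊢
  rw [fill_relabel]
  obtain ⟨e, he, hed⟩ := hb.tall_short h𝕊 hR
    (fun p => ⟨p.1.1.2.1.rews h𝕊 p.1.1.2.2, hτ p⟩) hrt
  obtain ⟨e', he', hed'⟩ := hb.tall_short h𝕊 hR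
    (fun p => ⟨p.1.2.2.1.rews h𝕊 p.1.2.2.2, hτ' p⟩) hrt'
  exact ⟨_, e, e', he, hed, he', hed'⟩

theorem ConfluentUpTo.succ (h𝕊 : IsShapeSystem R 𝕊) [Infinite V] (hR : LeftLinear R)
    (hconf : ConfluentUpTo R 𝕊 (m + 1) V) : ConfluentUpTo R 𝕊 (m + 2) V := by
  have hc : Confluent fun a b : F.Term V => Short h𝕊 m a b ∨ Tall h𝕊 m a b :=
    confluent_of_diagrams (fun a b h => Tall.refl h𝕊 h.1)
      (fun a b c h h' => short_short h𝕊 hR hconf h h') (fun a b c h h' => tall_short h𝕊 hR h h')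
      (fun a b c h h' => tall_tall h𝕊 hR hconf h h')
  have hto : ∀ a b : F.Term V, RankLE 𝕊 (m + 2) a → ReflTransGen (Rew R) a b →
      ReflTransGen (fun a b => Short h𝕊 m a b ∨ Tall h𝕊 m a b) a b := by
    intro a b ha h
    induction h with
    | refl => exact .refl
    | tail hab h ih => exact ih.tail (short_or_tall_of_rew h𝕊 (ha.rews h𝕊 hab) h)
  have hof : ∀ a b : F.Term V, ReflTransGen (fun a b => Short h𝕊 m a b ∨ Tall h𝕊 m a b) a b →
      ReflTransGen (Rew R) a b := by
    intro a b h
    induction h with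
    | refl => exact .refl
    | tail _ h ih => exact ih.trans (h.elim (Short.rews h𝕊) (Tall.rews h𝕊))
  intro a b c ha hab hac
  obtain ⟨d, hbd, hcd⟩ := hc a b c (hto a b ha hab) (hto a c ha hac)
  exact ⟨d, hof _ _ hbd, hof _ _ hcd⟩

/-- Confluence of a left-linear system from confluence on the terms of rank one. -/
theorem confluent_rew [Infinite V] (h𝕊 : IsShapeSystem R 𝕊) (hR : LeftLinear R)
    (hconf : ConfluentUpTo R 𝕊 1 V) : Confluent (Rew R : F.Term V → F.Term V → Prop) := by
  have h : ∀ n, ConfluentUpTo R 𝕊 (n + 1) V := by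
    intro n
    induction n with
    | zero => exact hconf
    | succ n ih => exact ih.succ h𝕊 hR
  intro a b c hab hac
  obtain ⟨n, hn⟩ := exists_rankLE h𝕊 a
  exact h n a b c (hn.succ h𝕊) hab hac

/-! ### From layer systems to shapes -/

theorem ctxLE_var_iff {a : Option V} {C : Ctx F V} :
    CtxLE (.var a) C ↔ a = none ∨ C = .var a := by
  constructor
  · intro h
    generalize hD : (Term.var a : Ctx F V) = D at h
    cases h with
    | hole => exact .inl (by simpa [hole] using hD)
    | var x =>
      cases hD
      exact .inr rfl
    | func f => cases hD
  · rintro (rfl | rfl)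
    · exact .hole C
    · exact .refl _

theorem ctxLE_func_iff {n : ℕ} {f : F.Functions n} {Cs : Fin n → Ctx F V} {D : Ctx F V} :
    CtxLE (.func f Cs) D ↔ ∃ Ds, D = .func f Ds ∧ ∀ i, CtxLE (Cs i) (Ds i) := by
  constructor
  · intro h
    cases h with
    | func _ _ Ds h => exact ⟨Ds, rfl, h⟩
  · rintro ⟨Ds, rfl, h⟩
    exact .func f Cs Ds h

theorem CtxLE.antisymm {C D : Ctx F V} (h : CtxLE C D) (h' : CtxLE D C) : C = D := by
  induction h with
  | hole C =>
    cases C with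
    | var a =>
      obtain rfl | h := ctxLE_var_iff.1 h'
      · rfl
      · exact h
    | func f Cs => obtain ⟨_, h, -⟩ := ctxLE_func_iff.1 h'; cases h
  | var x => rfl
  | func f Cs Ds _ ih =>
    obtain ⟨_, h, h'⟩ := ctxLE_func_iff.1 h'
    cases h
    congr 1
    funext i
    exact ih i (h' i)

theorem below_of_ctxLE {C D : Ctx F V} (h : CtxLE C D) : Below (C.relabel fun _ => ()) D := by
  induction h with
  | hole C => exact below_var _
  | var x => exact below_var _
  | func f Cs Ds _ ih => exact .func f ih

theorem ctxLE_relabel_none {D : Shape F} {C : Ctx F V} (h : Below D C) :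
    CtxLE (D.relabel fun _ => none) C := by
  induction h with
  | var h => exact .hole _
  | func f _ ih => exact .func f _ _ ih

/-- Contexts of a given shape below a term that have no hole in the place of a variable. -/
theorem exists_greatest_ctx {D : Shape F} {t : F.Term V} (h : Below D t) :
    ∃ M : Ctx F V, M.relabel (fun _ => ()) = D ∧ CtxLE M (toCtx t) ∧
      ∀ N, CtxLE N (toCtx t) → Below (N.relabel fun _ => ()) D → CtxLE N M := by
  induction h with
  | var h =>
    rename_i a t
    cases t with
    | var x =>
      exact ⟨.var (some x), rfl, .refl _, fun N hN _ => hN⟩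
    | func f ts =>
      refine ⟨hole, rfl, .hole _, fun N hN hN' => ?_⟩
      cases N with
      | var a =>
        obtain rfl | h := ctxLE_var_iff.1 hN
        · exact .refl _
        · simp [toCtx] at h
      | func g Ns => obtain ⟨_, h, -⟩ := below_func_iff.1 hN'; cases h
  | func f _ ih =>
    choose M h₁ h₂ h₃ using ih
    refine ⟨.func f M, by simp only [Term.relabel, h₁], .func f _ _ h₂, fun N hN hB => ?_⟩
    cases N with
    | var a =>
      obtain rfl | h := ctxLE_var_iff.1 hN
      · exact .hole _
      · simp [toCtx] at h
    | func g Ns =>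
      obtain ⟨_, h, hN⟩ := ctxLE_func_iff.1 hN
      simp only [toCtx, Term.relabel, Term.func.injEq] at h
      obtain ⟨rfl, hf, h⟩ := h
      obtain rfl := eq_of_heq hf
      obtain rfl := eq_of_heq h
      rw [Term.relabel, below_func_func_iff] at hB
      exact .func _ _ _ fun i => h₃ i _ (hN i) (hB i)

/-- The number of occurrences of variables in a context. -/
def varCount : Ctx F V → ℕ
  | .var none => 0
  | .var (some _) => 1
  | .func _ ts => ∑ i, varCount (ts i)

theorem exists_replaceAt_hole {C : Ctx F V} (h : varCount C ≠ 0) :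
    ∃ (p : List ℕ) (x : V), p ∈ positions C ∧ replaceAt C p (.var (some x)) = C ∧
      varCount (replaceAt C p hole) < varCount C ∧
      (replaceAt C p hole).relabel (fun _ => (none : Option V)) = C.relabel fun _ => none := by
  induction C with
  | var a =>
    cases a with
    | none => simp [varCount] at h
    | some x => exact ⟨[], x, by simp [positions, subtermAt], by simp [replaceAt],
        by simp [replaceAt, varCount, hole], by simp [replaceAt, hole]⟩
  | func f Cs ih =>
    obtain ⟨i, -, hi⟩ := Finset.exists_ne_zero_of_sum_ne_zero h
    obtain ⟨p, x, h₁, h₂, h₃, h₄⟩ := ih i hi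
    refine ⟨i :: p, x, ?_, ?_, ?_, ?_⟩
    · simpa [positions, subtermAt_func] using h₁
    · rw [replaceAt_func, h₂, Function.update_eq_self]
    · rw [replaceAt_func, varCount, varCount]
      refine Finset.sum_lt_sum (fun j _ => ?_) ⟨i, Finset.mem_univ i, by simpa using h₃⟩
      by_cases hj : j = i
      · subst hj; simpa using h₃.le
      · simp [hj]
    · rw [replaceAt_func, Term.relabel, Term.relabel]
      congr 1
      funext j
      by_cases hj : j = i
      · subst hj; simpa using h₄
      · simp [hj]

theorem relabel_none_of_varCount {C : Ctx F V} (h : varCount C = 0) :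
    (C.relabel fun _ => none) = C := by
  induction C with
  | var a =>
    cases a with
    | none => rfl
    | some x => simp [varCount] at h
  | func f Cs ih =>
    rw [varCount, Finset.sum_eq_zero_iff] at h
    rw [Term.relabel]
    congr 1
    funext i
    exact ih i (h i (Finset.mem_univ i))

variable {𝕃 : Set (Ctx F V)}

theorem IsLayerSystem.relabel_none_mem_iff (h𝕃 : IsLayerSystem 𝕃) (C : Ctx F V) :
    (C.relabel fun _ => none) ∈ 𝕃 ↔ C ∈ 𝕃 := by
  induction hn : varCount C using Nat.strong_induction_on generalizing C with
  | _ n ih =>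
    by_cases h : varCount C = 0
    · rw [relabel_none_of_varCount h]
    · obtain ⟨p, x, h₁, h₂, h₃, h₄⟩ := exists_replaceAt_hole h
      have := ih _ (hn ▸ h₃) _ rfl
      rw [h₄, ← h𝕃.L2 x C p h₁, h₂] at this
      exact this

/-- The shapes of the elements of `𝕃`. -/
def shapes (𝕃 : Set (Ctx F V)) : Set (Shape F) := {D | (D.relabel fun _ => none) ∈ 𝕃}

theorem IsLayerSystem.mem_shapes_iff (h𝕃 : IsLayerSystem 𝕃) {C : Ctx F V} :
    C.relabel (fun _ => ()) ∈ shapes 𝕃 ↔ C ∈ 𝕃 := by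
  rw [shapes, Set.mem_ofPred_eq, relabel_comp]
  exact h𝕃.relabel_none_mem_iff C

/-- A max-top keeps the variables of `t` at the leaves of `D` where `t` has one, and has holes at
the other leaves. -/
theorem IsLayerSystem.exists_isMaxTop (h𝕃 : IsLayerSystem 𝕃) {D : Shape F} {t : F.Term V}
    (h : IsGreatestTop (shapes 𝕃) D t) :
    ∃ M : Ctx F V, M.relabel (fun _ => ()) = D ∧ IsMaxTop 𝕃 M (toCtx t) := by
  obtain ⟨hD, hDt, hmax⟩ := h
  obtain ⟨M, rfl, hMt, hM⟩ := exists_greatest_ctx hDt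
  refine ⟨M, rfl, ⟨h𝕃.mem_shapes_iff.1 hD, hMt⟩, fun N hN hMN => hMN.antisymm ?_⟩
  exact hM N hN.2 (hmax _ (h𝕃.mem_shapes_iff.2 hN.1) (below_relabel_iff.1 (below_of_ctxLE hN.2)))

theorem IsLayerSystem.isShapeSystem [Nonempty V] (h𝕃 : IsLayerSystem 𝕃) {R : TRS F V}
    (hW : WeaklyLayered R 𝕃) : IsShapeSystem R (shapes 𝕃) where
  var_mem := by
    obtain ⟨x⟩ := ‹Nonempty V›
    obtain ⟨M, ⟨hM, hMx⟩, hne⟩ := h𝕃.L1 (.var x)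
    have hM' : M = .var (some x) := by
      cases M with
      | var a =>
        obtain rfl | h := ctxLE_var_iff.1 hMx
        · exact absurd rfl hne
        · exact h.symm
      | func f Ms => obtain ⟨_, h, -⟩ := ctxLE_func_iff.1 hMx; cases h
    rw [hM'] at hM
    exact h𝕃.mem_shapes_iff.2 hM
  exists_top := by
    intro n f ts
    obtain ⟨x⟩ := ‹Nonempty V›
    obtain ⟨M, ⟨hM, hMt⟩, hne⟩ := h𝕃.L1 ((Term.func f ts).relabel fun _ => x)
    have hM' := h𝕃.mem_shapes_iff.2 hM
    have hbelow := below_relabel_iff.1 (below_relabel_iff.1 (below_of_ctxLE hMt))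
    cases M with
    | var a =>
      obtain rfl | h := ctxLE_var_iff.1 hMt
      · exact absurd rfl hne
      · simp [toCtx] at h
    | func g Ms =>
      obtain ⟨_, h, hts⟩ := below_func_iff.1 hbelow
      cases h
      exact ⟨_, hM', hts⟩
  merge := by
    intro L hL N hN p hp D E hD hDE hNE hE
    have := h𝕃.L3 _ hL _ hN p ((mem_funPositions_relabel _).2 hp) (D.relabel fun _ => none)
      (E.relabel fun _ => none) (by rw [subtermAt_relabel, hD]; rfl)
      ⟨ctxLE_relabel_none (below_relabel_iff.2 hDE), ctxLE_relabel_none (below_relabel_iff.2 hNE),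
        fun C hDC hNC => ?_⟩
    · rwa [← replaceAt_relabel] at this
    · refine ctxLE_relabel_none (hE C ?_ ?_)
      · have := below_of_ctxLE hDC
        rw [relabel_comp, relabel_eq_subst] at this
        exact subst_var D ▸ this
      · have := below_of_ctxLE hNC
        rw [relabel_comp, relabel_eq_subst] at this
        exact subst_var N ▸ this
  step := by
    intro ρ hρ D s p τ hD hp hs
    obtain ⟨x⟩ := ‹Nonempty V›
    -- (W) speaks about terms, so the shape `s` is turned into a term with one variable `x` at all
    -- leaves.
    obtain ⟨M, rfl, hM⟩ := h𝕃.exists_isMaxTop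
      ((isGreatestTop_relabel_iff (g := fun _ => x)).2 hD)
    have hs' : subtermAt (s.relabel fun _ => x) p =
        some (ρ.lhs.subst fun y => (τ y).relabel fun _ => x) := by
      rw [← subst_relabel, subtermAt_relabel, hs, Option.map_some]
    obtain ⟨L, hL, σ, hσ, rfl⟩ := hW ρ hρ _ _ M p hM ((mem_funPositions_relabel _).1 hp)
      ⟨_, hs', rfl⟩
    refine ⟨fun y => (σ y).relabel fun _ => (), ?_, ?_⟩
    · rw [← subst_relabel, subtermAt_relabel, hσ, Option.map_some]
    · rw [← subst_relabel, ← replaceAt_relabel]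
      exact h𝕃.mem_shapes_iff.2 hL

/-! ### Comparison with terms of rank one -/

theorem aliens_toCtx (t : F.Term V) : aliens (toCtx t) t = [] := by
  induction t with
  | var x => simp [toCtx, aliens]
  | func f ts ih =>
    simp only [toCtx, Term.relabel, aliens, List.flatten_eq_nil_iff, List.mem_ofFn]
    rintro _ ⟨i, rfl⟩
    rw [dif_pos i.isLt]
    exact ih i

theorem toCtx_ne_hole (t : F.Term V) : toCtx t ≠ hole := by
  cases t <;> simp [toCtx, hole]

theorem rank_eq_one_of_toCtx_mem {t : F.Term V} (h : toCtx t ∈ 𝕃) : rank 𝕃 t = 1 := by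
  have hex : ∃ M, IsMaxTop 𝕃 M (toCtx t) ∧ M ≠ hole :=
    ⟨toCtx t, ⟨⟨h, .refl _⟩, fun N hN hN' => hN'.antisymm hN.2⟩, toCtx_ne_hole t⟩
  have hM : hex.choose = toCtx t :=
    hex.choose_spec.1.2 _ ⟨h, .refl _⟩ hex.choose_spec.1.1.2
  have hal : (aliens hex.choose t).attach = [] := by
    rw [List.attach_eq_nil_iff, hM, aliens_toCtx]
  rw [rank, dif_pos hex, hal]
  rfl

/-- Only variables sit in the holes of the witness `L`, so the whole term is a layer and its own
max-top. -/
theorem IsLayerSystem.rank_eq_one (h𝕃 : IsLayerSystem 𝕃) {t : F.Term V}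
    (h : RankLE (shapes 𝕃) 1 t) : rank 𝕃 t = 1 := by
  obtain ⟨L, hL, h⟩ := h
  have hLt : L = (toCtx t).relabel fun _ => () := by
    clear hL
    induction h with
    | var h => obtain ⟨x, rfl⟩ := h; rfl
    | func f _ ih =>
      simp only [toCtx, Term.relabel] at ih ⊢
      congr 1
      funext i
      exact ih i
  rw [hLt] at hL
  exact rank_eq_one_of_toCtx_mem (h𝕃.mem_shapes_iff.1 hL)

theorem rew_eq_step (R : TRS F V) : (Rew R : F.Term V → F.Term V → Prop) = Step R := by
  funext s t
  exact propext rew_iff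

theorem IsLayerSystem.confluentUpTo_one (h𝕃 : IsLayerSystem 𝕃) {R : TRS F V}
    (hconf : ConfluentOn (Step R) {t : F.Term V | rank 𝕃 t = 1}) :
    ConfluentUpTo R (shapes 𝕃) 1 V := by
  obtain ⟨hclosed, hconf⟩ := hconf
  intro a b c ha hab hac
  rw [rew_eq_step] at hab hac ⊢
  have ha := h𝕃.rank_eq_one ha
  have key : ∀ b, ReflTransGen (Step R) a b → rank 𝕃 b = 1 ∧ ReflTransGen (fun s t =>
      Step R s t ∧ s ∈ {t : F.Term V | rank 𝕃 t = 1} ∧ t ∈ {t : F.Term V | rank 𝕃 t = 1}) a b := by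
    intro b h
    induction h with
    | refl => exact ⟨ha, .refl⟩
    | tail _ h ih =>
      have := hclosed _ ih.1 _ h
      exact ⟨this, ih.2.tail ⟨h, ih.1, this⟩⟩
  obtain ⟨d, hbd, hcd⟩ := hconf a b c (key b hab).2 (key c hac).2
  exact ⟨d, hbd.lift id fun _ _ h => h.1, hcd.lift id fun _ _ h => h.1⟩

end Rewriting

theorem mainTheorem2 {F : FirstOrder.Language.{u, v}} {V : Type w} [Countable V] [Infinite V]
    (𝕃 : Set (Rewriting.Ctx F V)) (h𝕃 : Rewriting.IsLayerSystem 𝕃)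
    (R : Rewriting.TRS F V) (hW : Rewriting.WeaklyLayered R 𝕃)
    (hconf : Rewriting.ConfluentOn (Rewriting.Step R) {t : F.Term V | Rewriting.rank 𝕃 t = 1})
    (hlin : Rewriting.LeftLinear R) :
    Rewriting.Confluent (Rewriting.Step R) := by
  rw [← Rewriting.rew_eq_step]
  exact Rewriting.confluent_rew (h𝕃.isShapeSystem hW) hlin (h𝕃.confluentUpTo_one hconf)
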